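/- Let $\mathrm{Imm}(S^1,\mathbb R^2)$ be the space of $C^\infty$ immersions $c:S^1\to\mathbb R^2$ (smooth maps with $c_\theta\neq 0$ everywhere) and $\mathrm{Diff}(S^1)$ the group of $C^\infty$ diffeomorphisms of $S^1$. Fix a real number $A>0$ and an integer $n\ge 0$. For $c\in\mathrm{Imm}(S^1,\mathbb R^2)$ and $h\in C^\infty(S^1,\mathbb R^2)$ put $$D_s h=\frac{h_\theta}{|c_\theta|},\qquad L_{n,c}(h)=h+(-1)^nA\,D_s^{2n}h ,$$ so that $G^{\mathrm{imm},n}_c(h,k)=\int_{S^1}\big(\langle h,k\rangle+A\langle D_s^nh,D_s^nk\rangle\big)ds=\int_{S^1}\langle L_{n,c}(h),k\rangle\,ds$ with $ds=|c_\theta|\,d\theta$. Let $I\subseteq\mathbb R$ be an interval with more than one point and $0\in I$. A smooth path $I\to\mathrm{Imm}(S^1,\mathbb R^2)$ (resp. $I\to\mathrm{Diff}(S^1)$) is a family $c(t,\cdot)$ in $\mathrm{Imm}(S^1,\mathbb R^2)$ (resp. in $\mathrm{Diff}(S^1)$) that is jointly smooth on $I\times S^1$. Then there is a map $\Phi$ which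 assigns to every smooth path $c:I\to\mathrm{Imm}(S^1,\mathbb R^2)$ a smooth path $\varphi=\Phi(c):I\to\mathrm{Diff}(S^1)$ such that: 1. $\varphi(0,\cdot)=\mathrm{Id}_{S^1}$; 2. the reparametrized path $e(t,\theta)=c(t,\varphi(t,\theta))$ is $G^{\mathrm{imm},n}$-horizontal, that is $\langle L_{n,e}(e_t),e_\theta\rangle=0$ on $I\times S^1$; 3. $\varphi$ depends smoothly on $c$: for every $m\ge0$ and every family $(c_p)_{p\in\mathbb R^m}$ of smooth paths in $\mathrm{Imm}(S^1,\mathbb R^2)$ for which $(p,t,\theta)\mapsto c_p(t,\theta)$ is smooth on $\mathbb R^m\times I\times S^1$, the map $(p,t,\theta)\mapsto\Phi(c_p)(t,\theta)$ is smooth on $\mathbb R^m\times I\times S^1$ (for $m=1$: $\Phi$ maps smooth curves to smooth curves, which is smoothness in the sense of infinite-dimensional convenient calculus). -/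

import Mathlib

open Set
open scoped Manifold ContDiff

noncomputable section

namespace ShapeSpace

/-- The Euclidean plane `ℝ²`. -/
abbrev Plane : Type := EuclideanSpace ℝ (Fin 2)

/-- The group `Diff(S¹)` of smooth diffeomorphisms of the circle. -/
abbrev DiffCircle : Type := Diffeomorph (𝓡 1) (𝓡 1) Circle Circle ∞

/-- The derivative `f_θ = ∂f/∂θ` of a map on the circle, where `θ ↦ exp (i θ)` is the
angle coordinate. -/
def dTheta {V : Type*} [NormedAddCommGroup V] [NormedSpace ℝ V]
    (f : Circle → V) (z : Circle) : V :=
  deriv (fun θ : ℝ => f (z * Circle.exp θ)) 0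

/-- The space `Imm(S¹, ℝ²)`: smooth maps from the circle to the plane whose derivative `c_θ`
vanishes nowhere. -/
structure PlaneImmersion where
  toFun : Circle → Plane
  contMDiff : ContMDiff (𝓡 1) 𝓘(ℝ, Plane) ∞ toFun
  dTheta_ne_zero : ∀ z, dTheta toFun z ≠ 0

instance : CoeFun PlaneImmersion (fun _ => Circle → Plane) := ⟨PlaneImmersion.toFun⟩

/-- Let `S` be a subset of a normed space and let `g s : Circle → M` be a map for every `s ∈ S`.
The family is smooth if it is jointly smooth on `S × S¹`. (The values of `F` outside `S × S¹`
are irrelevant; they are there because smoothness on a set, up to and including boundary points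
of `S`, is expressed in Mathlib for maps on the ambient space.)

When `g` takes values in a space of smooth maps such as `Imm(S¹, ℝ²)` or `Diff(S¹)`, this is
smoothness of `g` as a map from `S` to that infinite dimensional manifold. -/
def SmoothFamily {E : Type*} [NormedAddCommGroup E] [NormedSpace ℝ E] (S : Set E)
    {F : Type*} [NormedAddCommGroup F] [NormedSpace ℝ F] {H : Type*} [TopologicalSpace H]
    (J : ModelWithCorners ℝ F H) {M : Type*} [TopologicalSpace M] [ChartedSpace H M]
    (g : S → Circle → M) : Prop :=
  ∃ G : E × Circle → M,
    ContMDiffOn (𝓘(ℝ, E).prod (𝓡 1)) J ∞ G (S ×ˢ (univ : Set Circle)) ∧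
      ∀ (s : S) (z : Circle), G (s, z) = g s z

/-- Smooth paths `I → Imm(S¹, ℝ²)`. -/
structure ImmPath (I : Set ℝ) where
  toFun : I → PlaneImmersion
  smooth : SmoothFamily I 𝓘(ℝ, Plane) (fun t z => toFun t z)

instance (I : Set ℝ) : CoeFun (ImmPath I) (fun _ => I → PlaneImmersion) := ⟨ImmPath.toFun⟩

/-- Smooth paths `I → Diff(S¹)`. -/
structure DiffPath (I : Set ℝ) where
  toFun : I → DiffCircle
  smooth : SmoothFamily I (𝓡 1) (fun t z => toFun t z)

instance (I : Set ℝ) : CoeFun (DiffPath I) (fun _ => I → DiffCircle) := ⟨DiffPath.toFun⟩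

/-- A family of paths `c p`, with `p` in a normed space `E`, depends smoothly on `p`: the map
`(p, t, z) ↦ c p t z` is smooth on `E × I × S¹`. -/
def SmoothInParam {E : Type*} [NormedAddCommGroup E] [NormedSpace ℝ E] {I : Set ℝ}
    {F : Type*} [NormedAddCommGroup F] [NormedSpace ℝ F] {H : Type*} [TopologicalSpace H]
    (J : ModelWithCorners ℝ F H) {M : Type*} [TopologicalSpace M] [ChartedSpace H M]
    (c : E → I → Circle → M) : Prop :=
  SmoothFamily ((univ : Set E) ×ˢ I) J (fun q z => c q.1.1 ⟨q.1.2, q.2.2⟩ z)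

/-- Smoothness of a map from the space of smooth paths in `Imm(S¹, ℝ²)` to the space of smooth
paths in `Diff(S¹)`, in the sense of the calculus on infinite dimensional (Fréchet and more
general convenient) spaces: a map is smooth if it sends smooth curves to smooth curves. We ask
for this for smooth families with any number `m` of real parameters; `m = 1` is the case of
curves. -/
def IsSmoothMap {I : Set ℝ} (Φ : ImmPath I → DiffPath I) : Prop :=
  ∀ (m : ℕ) (c : EuclideanSpace ℝ (Fin m) → ImmPath I),
    SmoothInParam 𝓘(ℝ, Plane) (fun p t z => c p t z) →
      SmoothInParam (𝓡 1) (fun p t z => Φ (c p) t z)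

/-- Differentiation with respect to arc length along `c`: `D_s f = f_θ / |c_θ|`. -/
def arcDeriv (c f : Circle → Plane) (z : Circle) : Plane :=
  ‖dTheta c z‖⁻¹ • dTheta f z

/-- The operator `L_{n,c} h = h + (-1)ⁿ A D_s^{2n} h` of the Sobolev metric
`G_c(h, k) = ∫ ⟨h, k⟩ + A ⟨D_sⁿ h, D_sⁿ k⟩ ds = ∫ ⟨L_{n,c} h, k⟩ ds`. -/
def sobolevOp (A : ℝ) (n : ℕ) (c h : Circle → Plane) (z : Circle) : Plane :=
  h z + ((-1) ^ n * A) • ((arcDeriv c)^[2 * n] h) z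

/-- The time derivative `e_t` at time `t ∈ I` (one-sided at an end point of `I`). The extension
by zero only serves to have a function on `ℝ`; the derivative is taken within `I`. -/
def timeDeriv {I : Set ℝ} (e : I → Circle → Plane) (t : I) (z : Circle) : Plane :=
  derivWithin (Function.extend Subtype.val (fun s : I => e s z) 0) I t

/-- The path `e` is horizontal: `⟨L_{n,e}(e_t), e_θ⟩ = 0` everywhere. -/
def IsHorizontal (A : ℝ) (n : ℕ) {I : Set ℝ} (e : I → Circle → Plane) : Prop :=
  ∀ (t : I) (z : Circle),
    inner ℝ (sobolevOp A n (e t) (timeDeriv e t) z) (dTheta (e t) z) = 0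

end ShapeSpace

end

/-!
The reparametrization is the flow of a time dependent vector field on the circle. If `φ` is the flow
of `α(t, θ) ∂/∂θ`, then `e = c ∘ φ` satisfies `e_t = (c_t + α c_θ) ∘ φ`, and since
arc length derivatives commute with reparametrizations, `L_e (e_t) = L_c (c_t + α c_θ) ∘ φ`
(`iterate_arcDerivLift_comp`). So `e` is horizontal as soon as `⟨L_c (c_t + α c_θ), c_θ⟩ = 0` for
every `t`.

With `v = c_θ / |c_θ|` and `a = |c_θ| α`, this is the equation `⟨L (a v), v⟩ = -⟨L c_t, v⟩` for a
function `a` on the circle. By Leibniz' rule it is a linear ordinary differential equation of order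
`2 n` with leading coefficient `± A` (for `n = 0` it is just `(1 + A) a = -⟨L c_t, v⟩`).
Integration by parts gives
`∫ a ⟨L (a v), v⟩ ds = ∫ |a v|² + A |D_sⁿ (a v)|² ds`, so the equation has no periodic solution for
the right hand side `0` but `a = 0`
(`IsPeriodicImmersion.eq_zero_of_inner_sobolevOpLift_eq_zero`). A linear periodic system with this
property has exactly one periodic solution for every right hand side, and its initial value is
`(1 - U(T))⁻¹ z(T)` in terms of the fundamental solution `U` and a particular solution `z`, hence
it is smooth in all parameters (`exists_contDiffOn_periodic_solution`). This gives a unique `α`, and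
it depends smoothly on `t` and on further parameters
(`IsImmersionFamily.exists_horizontalLift`).

Both the fundamental solution and the flow of `α` require smooth dependence of solutions on
parameters that range in a set with boundary, because time `t` is restricted to the interval `I`
(`contDiffOn_solution`). By Grönwall's inequality the derivative of a family of solutions with
respect to the parameter exists and solves the linearized equation; the family and its derivative
together solve a system of the same kind, and smoothness follows by induction on the order of
differentiability.

Maps on the circle are treated through their periodic lifts along `θ ↦ exp (i θ)`. The flow
preserves orientation, and its inverse is the flow from time `t` back to time `0`, so that the flow
maps are diffeomorphisms.
-/

noncomputable section

namespace ShapeSpace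

open Filter Topology
open scoped NNReal Real

/-! ### Ordinary differential equations on an interval -/

section ODE

variable {F : Type*} [NormedAddCommGroup F] [NormedSpace ℝ F]

/-- Grönwall's inequality forwards in time, with a bound in closed form. -/
theorem norm_le_of_hasDerivWithinAt_Icc_left {w w' : ℝ → F} {a b K ε : ℝ}
    (hK : 0 ≤ K) (hε : 0 ≤ ε)
    (hw : ∀ t ∈ Icc a b, HasDerivWithinAt w (w' t) (Icc a b) t)
    (bound : ∀ t ∈ Icc a b, ‖w' t‖ ≤ K * ‖w t‖ + ε) :
    ∀ t ∈ Icc a b, ‖w t‖ ≤ (‖w a‖ + ε * (b - a)) * Real.exp (K * (b - a)) := by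
  intro t ht
  have h1 := norm_le_gronwallBound_of_norm_deriv_right_le (f := w) (f' := w') (K := K) (ε := ε)
    (fun t ht => (hw t ht).continuousWithinAt)
    (fun x hx => ((hw x ⟨hx.1, hx.2.le⟩).mono (Icc_subset_Icc_left hx.1)).mono_of_mem_nhdsWithin
      (Icc_mem_nhdsGE hx.2)) le_rfl (fun x hx => bound x ⟨hx.1, hx.2.le⟩) t ht
  refine h1.trans ?_
  have hx0 : 0 ≤ t - a := sub_nonneg.2 ht.1
  have hxb : t - a ≤ b - a := sub_le_sub_right ht.2 a
  have hmono : Real.exp (K * (t - a)) ≤ Real.exp (K * (b - a)) :=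
    Real.exp_le_exp.2 (mul_le_mul_of_nonneg_left hxb hK)
  have h2 : gronwallBound ‖w a‖ K ε (t - a) ≤
      (‖w a‖ + ε * (t - a)) * Real.exp (K * (t - a)) := by
    rcases eq_or_ne K 0 with rfl | hK0
    · simp [gronwallBound_K0]
    · rw [gronwallBound_of_K_ne_0 hK0]
      have hKpos : 0 < K := lt_of_le_of_ne hK (Ne.symm hK0)
      -- `exp y - 1 ≤ y exp y`
      have h3 : Real.exp (K * (t - a)) - 1 ≤ K * (t - a) * Real.exp (K * (t - a)) := by
        have h4 := Real.add_one_le_exp (-(K * (t - a)))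
        have h5 : Real.exp (-(K * (t - a))) * Real.exp (K * (t - a)) = 1 := by
          rw [← Real.exp_add]; simp
        nlinarith [Real.exp_pos (K * (t - a))]
      have h6 : ε / K * (Real.exp (K * (t - a)) - 1) ≤
          ε / K * (K * (t - a) * Real.exp (K * (t - a))) :=
        mul_le_mul_of_nonneg_left h3 (by positivity)
      have h7 : ε / K * (K * (t - a) * Real.exp (K * (t - a))) =
          ε * (t - a) * Real.exp (K * (t - a)) := by
        field_simp
      linarith
  refine h2.trans ?_
  have : 0 ≤ b - a := hx0.trans hxb
  gcongr

/-- Grönwall's inequality on a compact interval, forwards and backwards in time from a base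
point `t₀`. -/
theorem norm_le_of_hasDerivWithinAt_Icc {w w' : ℝ → F} {a b t₀ K ε : ℝ} (ht₀ : t₀ ∈ Icc a b)
    (hK : 0 ≤ K) (hε : 0 ≤ ε)
    (hw : ∀ t ∈ Icc a b, HasDerivWithinAt w (w' t) (Icc a b) t)
    (bound : ∀ t ∈ Icc a b, ‖w' t‖ ≤ K * ‖w t‖ + ε) :
    ∀ t ∈ Icc a b, ‖w t‖ ≤ (‖w t₀‖ + ε * (b - a)) * Real.exp (K * (b - a)) := by
  intro t ht
  rcases le_total t₀ t with h | h
  · have h1 := norm_le_of_hasDerivWithinAt_Icc_left (a := t₀) (b := b) hK hε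
      (fun s hs => (hw s ⟨ht₀.1.trans hs.1, hs.2⟩).mono (Icc_subset_Icc_left ht₀.1))
      (fun s hs => bound s ⟨ht₀.1.trans hs.1, hs.2⟩) t ⟨h, ht.2⟩
    refine h1.trans ?_
    have := ht₀.1
    have : 0 ≤ b - a := by linarith [ht₀.2]
    gcongr
  · have h1 := norm_le_of_hasDerivWithinAt_Icc_left (w := fun s => w (-s))
      (w' := fun s => -w' (-s)) (a := -t₀) (b := -a) hK hε
      (fun s hs => by
        have hs' : -s ∈ Icc a b := ⟨by linarith [hs.2], by linarith [hs.1, ht₀.2]⟩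
        have := (hw (-s) hs').scomp s ((hasDerivAt_neg s).hasDerivWithinAt (s := Icc (-t₀) (-a)))
          (fun r hr => ⟨by linarith [hr.2], by linarith [hr.1, ht₀.2]⟩)
        simpa [Function.comp_def] using this)
      (fun s hs => by
        rw [norm_neg]
        exact bound (-s) ⟨by linarith [hs.2], by linarith [hs.1, ht₀.2]⟩) (-t)
      ⟨by linarith, by linarith [ht.1]⟩
    simp only [neg_neg] at h1
    refine h1.trans ?_
    have := ht₀.2
    have : 0 ≤ b - a := by linarith [ht₀.1]
    have h3 : -a - -t₀ = t₀ - a := by ring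
    rw [h3]
    gcongr

theorem eqOn_Icc_of_hasDerivWithinAt {f : ℝ → F → F} {u v : ℝ → F} {a b t₀ : ℝ}
    (ht₀ : t₀ ∈ Icc a b) {K : ℝ≥0} (hK : ∀ t ∈ Icc a b, LipschitzWith K (f t))
    (hu : ∀ t ∈ Icc a b, HasDerivWithinAt u (f t (u t)) (Icc a b) t)
    (hv : ∀ t ∈ Icc a b, HasDerivWithinAt v (f t (v t)) (Icc a b) t)
    (h0 : u t₀ = v t₀) : EqOn u v (Icc a b) := by
  intro t ht
  have := norm_le_of_hasDerivWithinAt_Icc (w := u - v) ht₀ K.2 le_rfl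
    (fun s hs => (hu s hs).sub (hv s hs))
    (fun s hs => by simpa [dist_eq_norm] using (hK s hs).dist_le_mul (u s) (v s)) t ht
  simpa [h0, sub_eq_zero] using this

/-- The radial retraction of a normed space to the closed ball of radius `R`. -/
def radialRetraction (R : ℝ) (x : F) : F := (R / max R ‖x‖) • x

theorem radialRetraction_of_norm_le {R : ℝ} (hR : 0 < R) {x : F} (hx : ‖x‖ ≤ R) :
    radialRetraction R x = x := by
  simp [radialRetraction, max_eq_left hx, hR.ne']

theorem norm_radialRetraction_le {R : ℝ} (hR : 0 < R) (x : F) :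
    ‖radialRetraction R x‖ ≤ R := by
  have hm : 0 < max R ‖x‖ := lt_max_of_lt_left hR
  rw [radialRetraction, norm_smul, Real.norm_of_nonneg (by positivity), div_mul_eq_mul_div,
    div_le_iff₀ hm]
  exact mul_le_mul_of_nonneg_left (le_max_right _ _) hR.le

theorem norm_radialRetraction_le_norm {R : ℝ} (hR : 0 < R) (x : F) :
    ‖radialRetraction R x‖ ≤ ‖x‖ := by
  have hm : 0 < max R ‖x‖ := lt_max_of_lt_left hR
  rw [radialRetraction, norm_smul, Real.norm_of_nonneg (by positivity)]
  exact mul_le_of_le_one_left (norm_nonneg _) ((div_le_one hm).2 (le_max_left _ _))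

theorem lipschitzWith_radialRetraction {R : ℝ} (hR : 0 < R) :
    LipschitzWith 2 (radialRetraction R : F → F) := by
  refine LipschitzWith.of_dist_le_mul fun x y => ?_
  rw [dist_eq_norm, dist_eq_norm]
  have hx : 0 < max R ‖x‖ := lt_max_of_lt_left hR
  have hy : 0 < max R ‖y‖ := lt_max_of_lt_left hR
  have key : radialRetraction R x - radialRetraction R y =
      (R / max R ‖x‖) • (x - y) +
        ((R / max R ‖x‖) * ((max R ‖y‖ - max R ‖x‖) / max R ‖y‖)) • y := by
    rw [radialRetraction, radialRetraction, smul_sub, sub_add, ← sub_smul]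
    congr 2
    field_simp
    ring
  have h1 : R / max R ‖x‖ ≤ 1 := (div_le_one hx).2 (le_max_left _ _)
  have h1' : 0 ≤ R / max R ‖x‖ := by positivity
  have h2 : ‖y‖ / max R ‖y‖ ≤ 1 := (div_le_one hy).2 (le_max_right _ _)
  have h3 : |max R ‖y‖ - max R ‖x‖| ≤ ‖x - y‖ := by
    have h4 := abs_max_sub_max_le_max R ‖y‖ R ‖x‖
    have h5 : |‖y‖ - ‖x‖| ≤ ‖x - y‖ := by
      rw [norm_sub_rev]; exact abs_norm_sub_norm_le y x
    simpa using h4.trans (max_le (by simp) h5)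
  have h6 : ‖(R / max R ‖x‖) • (x - y)‖ ≤ ‖x - y‖ := by
    rw [norm_smul, Real.norm_of_nonneg h1']
    exact mul_le_of_le_one_left (norm_nonneg _) h1
  have h7 : ‖((R / max R ‖x‖) * ((max R ‖y‖ - max R ‖x‖) / max R ‖y‖)) • y‖ ≤ ‖x - y‖ := by
    rw [norm_smul, norm_mul, Real.norm_of_nonneg h1', norm_div, Real.norm_of_nonneg hy.le,
      Real.norm_eq_abs]
    calc R / max R ‖x‖ * (|max R ‖y‖ - max R ‖x‖| / max R ‖y‖) * ‖y‖
        = (R / max R ‖x‖ * |max R ‖y‖ - max R ‖x‖|) * (‖y‖ / max R ‖y‖) := by ring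
      _ ≤ (1 * ‖x - y‖) * 1 := by gcongr
      _ = ‖x - y‖ := by ring
  rw [key]
  refine (norm_add_le _ _).trans ?_
  push_cast
  linarith

/-- A vector field that is globally Lipschitz in space has solutions on a compact interval,
however long. The Picard–Lindelöf theorem is applied to the bounded field obtained by composing
with a retraction to a ball; by Grönwall's inequality the solution never leaves the ball. -/
theorem exists_hasDerivWithinAt_Icc [CompleteSpace F] {f : ℝ → F → F} {a b t₀ : ℝ}
    (ht₀ : t₀ ∈ Icc a b) {K : ℝ≥0} (hf : ∀ x, ContinuousOn (fun t => f t x) (Icc a b))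
    (hK : ∀ t ∈ Icc a b, LipschitzWith K (f t)) (x₀ : F) :
    ∃ u : ℝ → F, u t₀ = x₀ ∧ ∀ t ∈ Icc a b, HasDerivWithinAt u (f t (u t)) (Icc a b) t := by
  obtain ⟨M, hM⟩ := isCompact_Icc.exists_bound_of_continuousOn (hf 0)
  have hM0 : 0 ≤ M := (norm_nonneg _).trans (hM t₀ ht₀)
  have hab : 0 ≤ b - a := by linarith [ht₀.1, ht₀.2]
  set R : ℝ := (‖x₀‖ + M * (b - a)) * Real.exp (K * (b - a)) + 1 with hRdef
  have hR : 0 < R := by positivity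
  have hgrow : ∀ t ∈ Icc a b, ∀ x, ‖f t x‖ ≤ K * ‖x‖ + M := fun t ht x => by
    have h1 := (hK t ht).dist_le_mul x 0
    rw [dist_eq_norm, dist_zero_right] at h1
    calc ‖f t x‖ = ‖(f t x - f t 0) + f t 0‖ := by simp
      _ ≤ ‖f t x - f t 0‖ + ‖f t 0‖ := norm_add_le _ _
      _ ≤ _ := add_le_add h1 (hM t ht)
  let L : ℝ≥0 := ⟨K * R + M, by positivity⟩
  let ρ : ℝ≥0 := L * ⟨max (b - t₀) (t₀ - a), le_max_of_le_left (sub_nonneg.2 ht₀.2)⟩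
  have hPL : IsPicardLindelof (fun t x => f t (radialRetraction R x)) (⟨t₀, ht₀⟩ : Icc a b) x₀
      ρ 0 L (K * 2) :=
    { lipschitzOnWith := fun t ht =>
        ((hK t ht).comp (lipschitzWith_radialRetraction hR)).lipschitzOnWith
      continuousOn := fun x _ => hf _
      norm_le := fun t ht x _ => (hgrow t ht _).trans <| by
        have := norm_radialRetraction_le hR x
        change _ ≤ K * R + M
        gcongr
      mul_max_le := by rw [NNReal.coe_zero, sub_zero]; exact le_rfl }
  obtain ⟨u, hu0, hu⟩ := hPL.exists_eq_forall_mem_Icc_hasDerivWithinAt₀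
  refine ⟨u, hu0, fun t ht => ?_⟩
  have hb := norm_le_of_hasDerivWithinAt_Icc ht₀ K.2 hM0 hu (fun s hs =>
    (hgrow s hs _).trans (add_le_add
      (mul_le_mul_of_nonneg_left (norm_radialRetraction_le_norm hR (u s)) K.2) le_rfl)) t ht
  simp only at hu0
  rw [hu0] at hb
  have := hu t ht
  rwa [radialRetraction_of_norm_le hR (hb.trans (by rw [hRdef]; exact (lt_add_one _).le))] at this

/-- Two points of an interval `J` lie in a compact subinterval which is a neighbourhood, relative
to `J`, of the second one. -/
theorem exists_Icc_mem_nhdsWithin {J : Set ℝ} (hJ : J.OrdConnected) {t₀ t₁ : ℝ} (h₀ : t₀ ∈ J)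
    (h₁ : t₁ ∈ J) :
    ∃ a b, Icc a b ⊆ J ∧ t₀ ∈ Icc a b ∧ t₁ ∈ Icc a b ∧ Icc a b ∈ 𝓝[J] t₁ := by
  have hb : ∃ b ∈ J, max t₀ t₁ ≤ b ∧ ∀ᶠ y in 𝓝[J] t₁, y ≤ b := by
    by_cases h : ∃ y ∈ J, max t₀ t₁ < y
    · obtain ⟨y, hy, hlt⟩ := h
      exact ⟨y, hy, hlt.le, mem_nhdsWithin_of_mem_nhds
        (Iic_mem_nhds ((le_max_right _ _).trans_lt hlt))⟩
    · push Not at h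
      refine ⟨max t₀ t₁, by rcases max_choice t₀ t₁ with h | h <;> rwa [h], le_rfl, ?_⟩
      filter_upwards [self_mem_nhdsWithin] with y hy using h y hy
  have ha : ∃ a ∈ J, a ≤ min t₀ t₁ ∧ ∀ᶠ y in 𝓝[J] t₁, a ≤ y := by
    by_cases h : ∃ y ∈ J, y < min t₀ t₁
    · obtain ⟨y, hy, hlt⟩ := h
      exact ⟨y, hy, hlt.le, mem_nhdsWithin_of_mem_nhds
        (Ici_mem_nhds (hlt.trans_le (min_le_right _ _)))⟩
    · push Not at h
      refine ⟨min t₀ t₁, by rcases min_choice t₀ t₁ with h | h <;> rwa [h], le_rfl, ?_⟩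
      filter_upwards [self_mem_nhdsWithin] with y hy using h y hy
  obtain ⟨b, hbJ, hbm, hb⟩ := hb
  obtain ⟨a, haJ, ham, ha⟩ := ha
  refine ⟨a, b, hJ.out haJ hbJ, ⟨ham.trans (min_le_left _ _), (le_max_left _ _).trans hbm⟩,
    ⟨ham.trans (min_le_right _ _), (le_max_right _ _).trans hbm⟩, ?_⟩
  filter_upwards [ha, hb] with y h1 h2 using ⟨h1, h2⟩

theorem eqOn_of_hasDerivWithinAt {f : ℝ → F → F} {u v : ℝ → F} {J : Set ℝ}
    (hJ : J.OrdConnected) {t₀ : ℝ} (ht₀ : t₀ ∈ J)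
    (hK : ∀ a b, Icc a b ⊆ J → ∃ K : ℝ≥0, ∀ t ∈ Icc a b, LipschitzWith K (f t))
    (hu : ∀ t ∈ J, HasDerivWithinAt u (f t (u t)) J t)
    (hv : ∀ t ∈ J, HasDerivWithinAt v (f t (v t)) J t)
    (h0 : u t₀ = v t₀) : EqOn u v J := by
  intro t ht
  obtain ⟨a, b, hab, h1, h2, -⟩ := exists_Icc_mem_nhdsWithin hJ ht₀ ht
  obtain ⟨K, hK⟩ := hK a b hab
  exact eqOn_Icc_of_hasDerivWithinAt h1 hK (fun s hs => (hu s (hab hs)).mono hab)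
    (fun s hs => (hv s (hab hs)).mono hab) h0 h2

/-- Global solutions on an arbitrary interval, for a vector field that is Lipschitz in space,
uniformly on compact time intervals. -/
theorem exists_hasDerivWithinAt [CompleteSpace F] {f : ℝ → F → F} {J : Set ℝ}
    (hJ : J.OrdConnected) {t₀ : ℝ} (ht₀ : t₀ ∈ J) (hf : ∀ x, ContinuousOn (fun t => f t x) J)
    (hK : ∀ a b, Icc a b ⊆ J → ∃ K : ℝ≥0, ∀ t ∈ Icc a b, LipschitzWith K (f t)) (x₀ : F) :
    ∃ u : ℝ → F, u t₀ = x₀ ∧ ∀ t ∈ J, HasDerivWithinAt u (f t (u t)) J t := by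
  choose a b hab h0 h1 hn using fun t : J => exists_Icc_mem_nhdsWithin hJ ht₀ t.2
  choose K hK using hK
  choose u hu0 hu using fun t : J =>
    exists_hasDerivWithinAt_Icc (h0 t) (fun x => (hf x).mono (hab t)) (hK _ _ (hab t)) x₀
  classical
  let w : ℝ → F := fun t => if h : t ∈ J then u ⟨t, h⟩ t else 0
  -- `w` agrees with the chosen local solution around `t`, by uniqueness on the intersection
  have hw : ∀ t : J, ∀ s ∈ Icc (a t) (b t), w s = u t s := by
    intro t s hs
    have hsJ : s ∈ J := hab t hs
    simp only [w, hsJ, dif_pos]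
    have hsub1 : Icc (max (a ⟨s, hsJ⟩) (a t)) (min (b ⟨s, hsJ⟩) (b t)) ⊆
        Icc (a ⟨s, hsJ⟩) (b ⟨s, hsJ⟩) :=
      Icc_subset_Icc (le_max_left _ _) (min_le_left _ _)
    have hsub2 : Icc (max (a ⟨s, hsJ⟩) (a t)) (min (b ⟨s, hsJ⟩) (b t)) ⊆ Icc (a t) (b t) :=
      Icc_subset_Icc (le_max_right _ _) (min_le_right _ _)
    exact eqOn_Icc_of_hasDerivWithinAt (t₀ := t₀) (K := K _ _ (hab t))
      ⟨max_le (h0 _).1 (h0 _).1, le_min (h0 _).2 (h0 _).2⟩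
      (fun r hr => hK _ _ (hab t) r (hsub2 hr))
      (fun r hr => (hu ⟨s, hsJ⟩ r (hsub1 hr)).mono hsub1)
      (fun r hr => (hu t r (hsub2 hr)).mono hsub2) (by rw [hu0, hu0])
      ⟨max_le (h1 ⟨s, hsJ⟩).1 hs.1, le_min (h1 ⟨s, hsJ⟩).2 hs.2⟩
  refine ⟨w, by rw [hw ⟨t₀, ht₀⟩ t₀ (h0 _), hu0], fun t ht => ?_⟩
  have h2 := (hu ⟨t, ht⟩ t (h1 _)).congr (hw _) (hw _ t (h1 _))
  rw [← hw ⟨t, ht⟩ t (h1 _)] at h2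
  exact h2.mono_of_mem_nhdsWithin (hn ⟨t, ht⟩)

end ODE

/-! ### Smooth dependence of solutions on parameters -/

section SmoothDependence

universe u

variable {E : Type u} [NormedAddCommGroup E] [NormedSpace ℝ E]

section Estimates

variable {F : Type*} [NormedAddCommGroup F] [NormedSpace ℝ F]
  {S : Set E} {J : Set ℝ} {q₀ : E} {a b : ℝ}

omit [NormedSpace ℝ E] [NormedSpace ℝ F] in
/-- Uniform bounds on compact sets of `(t, x)` for parameters near `q₀`. The parameter set `S` need
not be locally compact. -/
theorem exists_forall_norm_le_near [ProperSpace F] {G : Type*} [NormedAddCommGroup G]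
    {g : E × ℝ × F → G} (hg : ContinuousOn g (S ×ˢ J ×ˢ univ)) (hq₀ : q₀ ∈ S)
    (hab : Icc a b ⊆ J) (R : ℝ) :
    ∃ M, 0 ≤ M ∧ ∃ δ > 0, ∀ q ∈ S ∩ Metric.ball q₀ δ, ∀ t ∈ Icc a b, ∀ x ∈ Metric.closedBall 0 R,
      ‖g (q, t, x)‖ ≤ M := by
  have hcomp : IsCompact (Icc a b ×ˢ Metric.closedBall (0 : F) R) :=
    isCompact_Icc.prod (isCompact_closedBall _ _)
  obtain ⟨M, hM⟩ := hcomp.exists_bound_of_continuousOn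
    (f := fun y : ℝ × F => g (q₀, y)) (hg.comp (by fun_prop) fun y hy => ⟨hq₀, hab hy.1, trivial⟩)
  have h := hcomp.eventually_forall_of_forall_eventually (x₀ := q₀)
    (P := fun q y => q ∈ S → y ∈ Icc a b ×ˢ Metric.closedBall (0 : F) R → ‖g (q, y)‖ ≤ M + 1)
    (fun y hy => by
      have h1 := (hg (q₀, y) ⟨hq₀, hab hy.1, trivial⟩).norm
      have h2 : ∀ᶠ z in 𝓝[S ×ˢ J ×ˢ univ] (q₀, y), ‖g z‖ < M + 1 :=
        h1.eventually_lt_const (by linarith [hM y hy])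
      rw [eventually_nhdsWithin_iff] at h2
      filter_upwards [h2] with z hz hzS hzy
      exact (hz ⟨hzS, hab hzy.1, trivial⟩).le)
  obtain ⟨δ, hδ, hb⟩ := Metric.eventually_nhds_iff_ball.1 h
  refine ⟨max (M + 1) 0, le_max_right _ _, δ, hδ, fun q hq t ht x hx => ?_⟩
  exact (hb q hq.2 (t, x) ⟨ht, hx⟩ hq.1 ⟨ht, hx⟩).trans (le_max_left _ _)

omit [NormedSpace ℝ E] [NormedSpace ℝ F] in
/-- Continuity of `g` along the curve `t ↦ (q₀, t, ξ t)`, uniformly on compact time intervals. -/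
theorem exists_forall_norm_sub_le_near {G : Type*} [NormedAddCommGroup G]
    {g : E × ℝ × F → G} (hg : ContinuousOn g (S ×ˢ J ×ˢ univ)) (hq₀ : q₀ ∈ S)
    (hab : Icc a b ⊆ J) {ξ : ℝ → F} (hξ : ContinuousOn ξ J) {ε : ℝ} (hε : 0 < ε) :
    ∃ δ > 0, ∀ q ∈ S ∩ Metric.ball q₀ δ, ∀ t ∈ Icc a b, ∀ x ∈ Metric.ball (ξ t) δ,
      ‖g (q, t, x) - g (q₀, t, ξ t)‖ ≤ ε := by
  have h := (isCompact_Icc (a := a) (b := b)).eventually_forall_of_forall_eventually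
    (x₀ := ((q₀, 0) : E × F))
    (P := fun p t => p.1 ∈ S → t ∈ Icc a b → ‖g (p.1, t, ξ t + p.2) - g (q₀, t, ξ t)‖ ≤ ε)
    (fun t ht => by
      have hcont : ContinuousOn
          (fun z : (E × F) × ℝ => g (z.1.1, z.2, ξ z.2 + z.1.2) - g (q₀, z.2, ξ z.2))
          ((S ×ˢ univ) ×ˢ J) := by
        have hξ' : ContinuousOn (fun z : (E × F) × ℝ => ξ z.2) ((S ×ˢ univ) ×ˢ J) :=
          hξ.comp continuousOn_snd fun z hz => hz.2
        refine ContinuousOn.sub (hg.comp ?_ fun z hz => ⟨hz.1.1, hz.2, trivial⟩)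
          (hg.comp ?_ fun z hz => ⟨hq₀, hz.2, trivial⟩) <;> fun_prop
      have h1 := (hcont ((q₀, 0), t) ⟨⟨hq₀, trivial⟩, hab ht⟩).norm
      have h2 := h1.eventually_lt_const (u := ε) (by simpa using hε)
      rw [eventually_nhdsWithin_iff] at h2
      filter_upwards [h2] with z hz hzS hzt
      exact (hz ⟨⟨hzS, trivial⟩, hab hzt⟩).le)
  obtain ⟨δ, hδ, hb⟩ := Metric.eventually_nhds_iff_ball.1 h
  refine ⟨δ, hδ, fun q hq t ht x hx => ?_⟩
  have := hb (q, x - ξ t) (by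
    rw [← ball_prod_same]
    exact ⟨hq.2, by simpa [dist_eq_norm] using hx⟩) t ht hq.1 ht
  simpa using this

variable {f : E × ℝ × F → F} {f' : E × ℝ × F → (E × ℝ × F →L[ℝ] F)} {t₀ : ℝ} {u : E × ℝ → F}

/-- Solutions are locally Lipschitz functions of the parameter. -/
theorem exists_eventually_norm_solution_sub_le [ProperSpace F] (hS : Convex ℝ S)
    (hf' : ∀ z ∈ S ×ˢ J ×ˢ univ, HasFDerivWithinAt f (f' z) (S ×ˢ J ×ˢ univ) z)
    (hf'c : ContinuousOn f' (S ×ˢ J ×ˢ univ))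
    (hu : ∀ q ∈ S, ∀ t ∈ J, HasDerivWithinAt (fun s => u (q, s)) (f (q, t, u (q, t))) J t)
    (hu₀ : DifferentiableOn ℝ (fun q => u (q, t₀)) S)
    (hab : Icc a b ⊆ J) (ht₀ : t₀ ∈ Icc a b) (hq₀ : q₀ ∈ S) {R : ℝ}
    (hR : ∀ᶠ q in 𝓝[S] q₀, ∀ t ∈ Icc a b, ‖u (q, t)‖ ≤ R) :
    ∃ C, 0 ≤ C ∧ ∀ᶠ q in 𝓝[S] q₀, ∀ t ∈ Icc a b, ‖u (q, t) - u (q₀, t)‖ ≤ C * ‖q - q₀‖ := by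
  obtain ⟨M, hM0, δ, hδ, hM⟩ := exists_forall_norm_le_near hf'c hq₀ hab R
  obtain ⟨C₀, hC₀0, hC₀⟩ := (hu₀ q₀ hq₀).hasFDerivWithinAt.isBigO_sub.exists_nonneg
  have hba : 0 ≤ b - a := by linarith [ht₀.1, ht₀.2]
  refine ⟨(C₀ + M * (b - a)) * Real.exp (M * (b - a)), by positivity, ?_⟩
  have hRq₀ := hR.self_of_nhdsWithin hq₀
  filter_upwards [hR, hC₀.bound, self_mem_nhdsWithin,
    mem_nhdsWithin_of_mem_nhds (Metric.ball_mem_nhds q₀ hδ)] with q hq hqC hqS hqδ t ht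
  have key := norm_le_of_hasDerivWithinAt_Icc (w := fun t => u (q, t) - u (q₀, t))
    (K := M) (ε := M * ‖q - q₀‖) ht₀ hM0 (by positivity)
    (fun s hs => ((hu q hqS s (hab hs)).mono hab).sub ((hu q₀ hq₀ s (hab hs)).mono hab))
    (fun s hs => by
      have hconv : Convex ℝ ((S ∩ Metric.ball q₀ δ) ×ˢ ({s} : Set ℝ) ×ˢ
          Metric.closedBall (0 : F) R) :=
        (hS.inter (convex_ball _ _)).prod ((convex_singleton _).prod (convex_closedBall _ _))
      have hmv := hconv.norm_image_sub_le_of_norm_hasFDerivWithin_le (f := f) (f' := f') (C := M)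
        (x := (q₀, s, u (q₀, s))) (y := (q, s, u (q, s)))
        (fun z hz => (hf' z ⟨hz.1.1, by rw [hz.2.1]; exact hab hs, trivial⟩).mono
          (fun y hy => ⟨hy.1.1, by rw [hy.2.1]; exact hab hs, trivial⟩))
        (fun z hz => hM z.1 hz.1 z.2.1 (by rw [hz.2.1]; exact hs) z.2.2 hz.2.2)
        ⟨⟨hq₀, Metric.mem_ball_self hδ⟩, rfl, by simpa using hRq₀ s hs⟩
        ⟨⟨hqS, hqδ⟩, rfl, by simpa using hq s hs⟩
      refine hmv.trans ?_
      have h1 : ‖((q, s, u (q, s)) : E × ℝ × F) - (q₀, s, u (q₀, s))‖ ≤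
          ‖u (q, s) - u (q₀, s)‖ + ‖q - q₀‖ := by
        simp only [Prod.mk_sub_mk, Prod.norm_def, sub_self, norm_zero]
        refine max_le (by linarith [norm_nonneg (u (q, s) - u (q₀, s))])
          (max_le (by positivity) (by linarith [norm_nonneg (q - q₀)]))
      calc _ ≤ M * (‖u (q, s) - u (q₀, s)‖ + ‖q - q₀‖) := by gcongr
        _ = _ := by ring) t ht
  refine key.trans ?_
  calc (‖u (q, t₀) - u (q₀, t₀)‖ + M * ‖q - q₀‖ * (b - a)) * Real.exp (M * (b - a))
      ≤ (C₀ * ‖q - q₀‖ + M * ‖q - q₀‖ * (b - a)) * Real.exp (M * (b - a)) := by gcongr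
    _ = _ := by ring

/-- The solution `v` of the linearized equation along `u (q₀, ·)` is the derivative of the
solution with respect to the parameter, uniformly on compact time intervals. -/
theorem eventually_norm_solution_sub_sub_le [ProperSpace F] (hS : Convex ℝ S)
    (hf' : ∀ z ∈ S ×ˢ J ×ˢ univ, HasFDerivWithinAt f (f' z) (S ×ˢ J ×ˢ univ) z)
    (hf'c : ContinuousOn f' (S ×ˢ J ×ˢ univ))
    (hu : ∀ q ∈ S, ∀ t ∈ J, HasDerivWithinAt (fun s => u (q, s)) (f (q, t, u (q, t))) J t)
    (hab : Icc a b ⊆ J) (ht₀ : t₀ ∈ Icc a b) (hq₀ : q₀ ∈ S) {R : ℝ}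
    (hR : ∀ᶠ q in 𝓝[S] q₀, ∀ t ∈ Icc a b, ‖u (q, t)‖ ≤ R)
    {v : ℝ → E →L[ℝ] F}
    (hv₀ : HasFDerivWithinAt (fun q => u (q, t₀)) (v t₀) S q₀)
    (hu₀ : DifferentiableOn ℝ (fun q => u (q, t₀)) S)
    (hv : ∀ t ∈ J, ∀ e : E, HasDerivWithinAt (fun s => v s e)
      (f' (q₀, t, u (q₀, t)) (e, 0, v t e)) J t)
    {ε : ℝ} (hε : 0 < ε) :
    ∀ᶠ q in 𝓝[S] q₀, ∀ t ∈ Icc a b,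
      ‖u (q, t) - u (q₀, t) - v t (q - q₀)‖ ≤ ε * ‖q - q₀‖ := by
  obtain ⟨C, hC0, hC⟩ := exists_eventually_norm_solution_sub_le hS hf' hf'c hu hu₀ hab ht₀ hq₀ hR
  obtain ⟨M, hM0, δ₁, hδ₁, hM⟩ := exists_forall_norm_le_near hf'c hq₀ hab R
  have hba : 0 ≤ b - a := by linarith [ht₀.1, ht₀.2]
  have hRq₀ := hR.self_of_nhdsWithin hq₀
  have hM' : ∀ t ∈ Icc a b, ‖f' (q₀, t, u (q₀, t))‖ ≤ M := fun t ht =>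
    hM q₀ ⟨hq₀, Metric.mem_ball_self hδ₁⟩ t ht _ (by simpa using hRq₀ t ht)
  -- Grönwall's inequality will give the bound `η * P * ‖q - q₀‖`, if `η` bounds the oscillation
  -- of `f'` around the reference solution
  set P : ℝ := (1 + (C + 1) * (b - a)) * Real.exp (M * (b - a)) with hP
  have hP0 : 0 < P := by positivity
  set η : ℝ := ε / P with hη
  have hη0 : 0 < η := by positivity
  have hucont : ContinuousOn (fun t => u (q₀, t)) J := fun t ht =>
    (hu q₀ hq₀ t ht).continuousWithinAt
  obtain ⟨δ, hδ, hcl⟩ := exists_forall_norm_sub_le_near hf'c hq₀ hab hucont hη0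
  have hsmall : ∀ᶠ q in 𝓝[S] q₀, C * ‖q - q₀‖ < δ := by
    have : Tendsto (fun q : E => C * ‖q - q₀‖) (𝓝[S] q₀) (𝓝 (C * ‖q₀ - q₀‖)) :=
      (Continuous.tendsto (by fun_prop) q₀).mono_left nhdsWithin_le_nhds
    exact this.eventually_lt_const (by simpa using hδ)
  filter_upwards [hC, hsmall, self_mem_nhdsWithin, hv₀.isLittleO.def hη0,
    mem_nhdsWithin_of_mem_nhds (Metric.ball_mem_nhds q₀ hδ)] with q hq hqδ' hqS hq0 hqδ t ht
  have key := norm_le_of_hasDerivWithinAt_Icc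
    (w := fun t => u (q, t) - u (q₀, t) - v t (q - q₀))
    (K := M) (ε := η * (C + 1) * ‖q - q₀‖) ht₀ hM0 (by positivity)
    (fun s hs => (((hu q hqS s (hab hs)).mono hab).sub ((hu q₀ hq₀ s (hab hs)).mono hab)).sub
      ((hv s (hab hs) _).mono hab))
    (fun s hs => by
      have hconv : Convex ℝ ((S ∩ Metric.ball q₀ δ) ×ˢ ({s} : Set ℝ) ×ˢ
          Metric.ball (u (q₀, s)) δ) :=
        (hS.inter (convex_ball _ _)).prod ((convex_singleton _).prod (convex_ball _ _))
      have hmv := hconv.norm_image_sub_le_of_norm_hasFDerivWithin_le' (f := f) (f' := f') (C := η)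
        (φ := f' (q₀, s, u (q₀, s)))
        (x := (q₀, s, u (q₀, s))) (y := (q, s, u (q, s)))
        (fun z hz => (hf' z ⟨hz.1.1, by rw [hz.2.1]; exact hab hs, trivial⟩).mono
          (fun y hy => ⟨hy.1.1, by rw [hy.2.1]; exact hab hs, trivial⟩))
        (fun z hz => by
          obtain ⟨z1, z2, z3⟩ := z
          obtain ⟨hz1, rfl, hz3⟩ := hz
          exact hcl z1 hz1 z2 hs z3 hz3)
        ⟨⟨hq₀, Metric.mem_ball_self hδ⟩, rfl, Metric.mem_ball_self hδ⟩
        ⟨⟨hqS, hqδ⟩, rfl, by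
          rw [Metric.mem_ball, dist_eq_norm]; exact (hq s hs).trans_lt hqδ'⟩
      have hsub : ((q, s, u (q, s)) : E × ℝ × F) - (q₀, s, u (q₀, s)) =
          (q - q₀, 0, u (q, s) - u (q₀, s)) := by simp
      have h1 : ‖((q - q₀, 0, u (q, s) - u (q₀, s)) : E × ℝ × F)‖ ≤ (C + 1) * ‖q - q₀‖ := by
        simp only [Prod.norm_def, norm_zero]
        have := hq s hs
        have := norm_nonneg (q - q₀)
        refine max_le (by nlinarith) (max_le (by positivity) (by linarith))
      have hsplit : ((q - q₀, 0, u (q, s) - u (q₀, s)) : E × ℝ × F) =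
          (q - q₀, 0, v s (q - q₀)) + (0, 0, u (q, s) - u (q₀, s) - v s (q - q₀)) := by simp
      rw [hsub] at hmv
      have h2 : f (q, s, u (q, s)) - f (q₀, s, u (q₀, s)) -
            f' (q₀, s, u (q₀, s)) (q - q₀, 0, v s (q - q₀)) =
          (f (q, s, u (q, s)) - f (q₀, s, u (q₀, s)) -
            f' (q₀, s, u (q₀, s)) (q - q₀, 0, u (q, s) - u (q₀, s))) +
          f' (q₀, s, u (q₀, s)) (0, 0, u (q, s) - u (q₀, s) - v s (q - q₀)) := by
        rw [hsplit, map_add]; abel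
      rw [h2]
      refine (norm_add_le _ _).trans ?_
      have h3 : ‖f' (q₀, s, u (q₀, s)) (0, 0, u (q, s) - u (q₀, s) - v s (q - q₀))‖ ≤
          M * ‖u (q, s) - u (q₀, s) - v s (q - q₀)‖ := by
        refine ((f' (q₀, s, u (q₀, s))).le_opNorm _).trans ?_
        simp only [Prod.norm_def, norm_zero]
        rw [max_eq_right (norm_nonneg _), max_eq_right (norm_nonneg _)]
        exact mul_le_mul_of_nonneg_right (hM' s hs) (norm_nonneg _)
      have h4 : η * ‖((q - q₀, 0, u (q, s) - u (q₀, s)) : E × ℝ × F)‖ ≤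
          η * (C + 1) * ‖q - q₀‖ := by
        rw [mul_assoc]; gcongr
      linarith) t ht
  refine key.trans ?_
  calc (‖u (q, t₀) - u (q₀, t₀) - v t₀ (q - q₀)‖ + η * (C + 1) * ‖q - q₀‖ * (b - a)) *
        Real.exp (M * (b - a))
      ≤ (η * ‖q - q₀‖ + η * (C + 1) * ‖q - q₀‖ * (b - a)) * Real.exp (M * (b - a)) := by gcongr
    _ = η * P * ‖q - q₀‖ := by rw [hP]; ring
    _ = ε * ‖q - q₀‖ := by rw [hη, div_mul_cancel₀ _ hP0.ne']

/-- A family of solutions is differentiable in parameter and time jointly. This combines the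
derivative in the parameter, which is uniform in time, with the derivative in time at the fixed
parameter `q₀`. -/
theorem hasFDerivWithinAt_solution [ProperSpace F] (hS : Convex ℝ S) (hJ : J.OrdConnected)
    (hf' : ∀ z ∈ S ×ˢ J ×ˢ univ, HasFDerivWithinAt f (f' z) (S ×ˢ J ×ˢ univ) z)
    (hf'c : ContinuousOn f' (S ×ˢ J ×ˢ univ))
    (hu : ∀ q ∈ S, ∀ t ∈ J, HasDerivWithinAt (fun s => u (q, s)) (f (q, t, u (q, t))) J t)
    (ht₀ : t₀ ∈ J) (hq₀ : q₀ ∈ S)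
    (hR : ∀ a b, Icc a b ⊆ J → t₀ ∈ Icc a b →
      ∃ R, ∀ᶠ q in 𝓝[S] q₀, ∀ t ∈ Icc a b, ‖u (q, t)‖ ≤ R)
    {v : ℝ → E →L[ℝ] F}
    (hv₀ : HasFDerivWithinAt (fun q => u (q, t₀)) (v t₀) S q₀)
    (hu₀ : DifferentiableOn ℝ (fun q => u (q, t₀)) S)
    (hv : ∀ t ∈ J, ∀ e : E, HasDerivWithinAt (fun s => v s e)
      (f' (q₀, t, u (q₀, t)) (e, 0, v t e)) J t)
    (hvc : ContinuousOn v J) {t₁ : ℝ} (ht₁ : t₁ ∈ J) :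
    HasFDerivWithinAt u ((v t₁).coprod (ContinuousLinearMap.toSpanSingleton ℝ
      (f (q₀, t₁, u (q₀, t₁))))) (S ×ˢ J) (q₀, t₁) := by
  obtain ⟨a, b, hab, h0, h1, hn⟩ := exists_Icc_mem_nhdsWithin hJ ht₀ ht₁
  obtain ⟨R, hR⟩ := hR a b hab h0
  refine .of_isLittleO (Asymptotics.IsLittleO.of_bound fun ε hε => ?_)
  have hε3 : 0 < ε / 3 := by positivity
  have hfst : Tendsto Prod.fst (𝓝[S ×ˢ J] (q₀, t₁)) (𝓝[S] q₀) := by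
    rw [nhdsWithin_prod_eq]; exact tendsto_fst
  have hsnd : Tendsto Prod.snd (𝓝[S ×ˢ J] (q₀, t₁)) (𝓝[J] t₁) := by
    rw [nhdsWithin_prod_eq]; exact tendsto_snd
  have e1 := hfst.eventually
    (eventually_norm_solution_sub_sub_le hS hf' hf'c hu hab h0 hq₀ hR hv₀ hu₀ hv hε3)
  have e2 : ∀ᶠ z : E × ℝ in 𝓝[S ×ˢ J] (q₀, t₁), ‖v z.2 - v t₁‖ < ε / 3 := by
    have : ContinuousWithinAt (fun t => ‖v t - v t₁‖) J t₁ :=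
      ((hvc t₁ ht₁).sub continuousWithinAt_const).norm
    exact hsnd.eventually (this.eventually_lt_const (by simpa using hε3))
  have e3 := hsnd.eventually ((hu q₀ hq₀ t₁ ht₁).hasFDerivWithinAt.isLittleO.def hε3)
  filter_upwards [e1, e2, e3, hsnd hn] with z h1 h2 h3 h4
  obtain ⟨q, t⟩ := z
  simp only at h1 h2 h3 h4
  have hsplit : u (q, t) - u (q₀, t₁) - ((v t₁).coprod (ContinuousLinearMap.toSpanSingleton ℝ
        (f (q₀, t₁, u (q₀, t₁))))) ((q, t) - (q₀, t₁)) =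
      (u (q, t) - u (q₀, t) - v t (q - q₀)) + (v t - v t₁) (q - q₀) +
        (u (q₀, t) - u (q₀, t₁) - (ContinuousLinearMap.toSpanSingleton ℝ
        (f (q₀, t₁, u (q₀, t₁)))) (t - t₁)) := by
    simp only [Prod.mk_sub_mk, ContinuousLinearMap.coprod_apply, sub_apply]
    abel
  have hn1 : ‖q - q₀‖ ≤ ‖((q, t) : E × ℝ) - (q₀, t₁)‖ := norm_fst_le (q - q₀, t - t₁)
  have hn2 : ‖t - t₁‖ ≤ ‖((q, t) : E × ℝ) - (q₀, t₁)‖ := norm_snd_le (q - q₀, t - t₁)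
  rw [hsplit]
  refine (norm_add₃_le).trans ?_
  have k1 := (h1 t h4).trans (mul_le_mul_of_nonneg_left hn1 hε3.le)
  have k2 : ‖(v t - v t₁) (q - q₀)‖ ≤ ε / 3 * ‖((q, t) : E × ℝ) - (q₀, t₁)‖ :=
    ((v t - v t₁).le_opNorm _).trans (mul_le_mul h2.le hn1 (norm_nonneg _) hε3.le)
  have k3 := h3.trans (mul_le_mul_of_nonneg_left hn2 hε3.le)
  simp only [ContinuousLinearMap.toSpanSingleton_apply] at k3 ⊢
  linarith

end Estimates

/-- The linear map `e ↦ (e, 0, V e)`: if the parameter `q` varies by `e` and `V` is the derivative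
of a family of solutions `u` with respect to `q`, this is the variation of `(q, t, u (q, t))`. -/
def variationMap {F : Type*} [NormedAddCommGroup F] [NormedSpace ℝ F] (V : E →L[ℝ] F) :
    E →L[ℝ] E × ℝ × F :=
  ContinuousLinearMap.inl ℝ E (ℝ × F) +
    ((ContinuousLinearMap.inr ℝ E (ℝ × F)).comp (ContinuousLinearMap.inr ℝ ℝ F)).comp V

@[simp]
theorem variationMap_apply {F : Type*} [NormedAddCommGroup F] [NormedSpace ℝ F]
    (V : E →L[ℝ] F) (e : E) : variationMap V e = (e, 0, V e) := by
  simp [variationMap]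

theorem norm_variationMap_le {F : Type*} [NormedAddCommGroup F] [NormedSpace ℝ F]
    (V : E →L[ℝ] F) : ‖variationMap V‖ ≤ ‖V‖ + 1 := by
  refine ContinuousLinearMap.opNorm_le_bound _ (by positivity) fun e => ?_
  have := V.le_opNorm e
  have := norm_nonneg e
  have := norm_nonneg V
  simp only [variationMap_apply, Prod.norm_def, norm_zero]
  refine max_le (by nlinarith) (max_le (by positivity) (by nlinarith))

theorem norm_variationMap_sub_le {F : Type*} [NormedAddCommGroup F] [NormedSpace ℝ F]
    (V W : E →L[ℝ] F) : ‖variationMap V - variationMap W‖ ≤ ‖V - W‖ := by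
  refine ContinuousLinearMap.opNorm_le_bound _ (norm_nonneg _) fun e => ?_
  have := (V - W).le_opNorm e
  simpa [Prod.norm_def] using this

theorem contDiff_variationMap {F : Type*} [NormedAddCommGroup F] [NormedSpace ℝ F]
    {n : WithTop ℕ∞} : ContDiff ℝ n (variationMap : (E →L[ℝ] F) → (E →L[ℝ] E × ℝ × F)) :=
  contDiff_const.add (contDiff_const.clm_comp contDiff_id)

variable {S : Set E} {J : Set ℝ} {t₀ : ℝ}

/-- The first variation of a smooth family of solutions: it solves the linearized equation, it is
locally bounded, and it is the derivative of the family with respect to the parameter. -/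
theorem exists_variation (hS : Convex ℝ S) (hSu : UniqueDiffOn ℝ S)
    (hJ : J.OrdConnected) (hJu : UniqueDiffOn ℝ J) (ht₀ : t₀ ∈ J)
    {F : Type u} [NormedAddCommGroup F] [NormedSpace ℝ F] [FiniteDimensional ℝ F]
    {f : E × ℝ × F → F} {u : E × ℝ → F} (hf : ContDiffOn ℝ ∞ f (S ×ˢ J ×ˢ univ))
    (hu : ∀ q ∈ S, ∀ t ∈ J, HasDerivWithinAt (fun s => u (q, s)) (f (q, t, u (q, t))) J t)
    (hu₀ : ContDiffOn ℝ ∞ (fun q => u (q, t₀)) S)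
    (hR : ∀ q₀ ∈ S, ∀ a b, Icc a b ⊆ J → t₀ ∈ Icc a b →
      ∃ R, ∀ᶠ q in 𝓝[S] q₀, ∀ t ∈ Icc a b, ‖u (q, t)‖ ≤ R) :
    ∃ v : E × ℝ → (E →L[ℝ] F),
      (∀ q ∈ S, v (q, t₀) = fderivWithin ℝ (fun q => u (q, t₀)) S q) ∧
      (∀ q ∈ S, ∀ t ∈ J, HasDerivWithinAt (fun s => v (q, s))
        ((fderivWithin ℝ f (S ×ˢ J ×ˢ univ) (q, t, u (q, t))).comp
          (variationMap (v (q, t)))) J t) ∧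
      (∀ q₀ ∈ S, ∀ a b, Icc a b ⊆ J → t₀ ∈ Icc a b →
        ∃ R, ∀ᶠ q in 𝓝[S] q₀, ∀ t ∈ Icc a b, ‖v (q, t)‖ ≤ R) ∧
      ∀ z ∈ S ×ˢ J, HasFDerivWithinAt u
        ((v z).coprod (ContinuousLinearMap.toSpanSingleton ℝ (f (z.1, z.2, u z)))) (S ×ˢ J) z := by
  have hΩ : UniqueDiffOn ℝ (S ×ˢ J ×ˢ (univ : Set F)) := hSu.prod (hJu.prod uniqueDiffOn_univ)
  have hf'c : ContinuousOn (fderivWithin ℝ f (S ×ˢ J ×ˢ univ)) (S ×ˢ J ×ˢ univ) :=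
    hf.continuousOn_fderivWithin hΩ (by simp)
  have hf' : ∀ z ∈ S ×ˢ J ×ˢ univ,
      HasFDerivWithinAt f (fderivWithin ℝ f (S ×ˢ J ×ˢ univ) z) (S ×ˢ J ×ˢ univ) z := fun z hz =>
    (hf.differentiableOn (by simp) z hz).hasFDerivWithinAt
  set f' := fderivWithin ℝ f (S ×ˢ J ×ˢ univ) with hf'def
  have hdu₀ : DifferentiableOn ℝ (fun q => u (q, t₀)) S := hu₀.differentiableOn (by simp)
  have hcont : ∀ q ∈ S, ContinuousOn (fun t => f' (q, t, u (q, t))) J := fun q hq =>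
    hf'c.comp (continuousOn_const.prodMk (continuousOn_id.prodMk
      fun t ht => (hu q hq t ht).continuousWithinAt)) fun t ht => ⟨hq, ht, trivial⟩
  have hex : ∀ q ∈ S, ∃ V : ℝ → (E →L[ℝ] F),
      V t₀ = fderivWithin ℝ (fun q => u (q, t₀)) S q ∧
      ∀ t ∈ J, HasDerivWithinAt V ((f' (q, t, u (q, t))).comp (variationMap (V t))) J t := by
    intro q hq
    refine exists_hasDerivWithinAt (f := fun t V => (f' (q, t, u (q, t))).comp (variationMap V))
      hJ ht₀ (fun V => (hcont q hq).clm_comp continuousOn_const) (fun a b hab => ?_) _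
    obtain ⟨K, hK⟩ := isCompact_Icc.exists_bound_of_continuousOn ((hcont q hq).mono hab)
    refine ⟨K.toNNReal, fun t ht => LipschitzWith.of_dist_le_mul fun V W => ?_⟩
    rw [dist_eq_norm, dist_eq_norm, ← ContinuousLinearMap.comp_sub]
    refine (ContinuousLinearMap.opNorm_comp_le _ _).trans ?_
    exact mul_le_mul ((hK t ht).trans (Real.le_coe_toNNReal K)) (norm_variationMap_sub_le V W)
      (norm_nonneg _) (NNReal.coe_nonneg _)
  choose! V hV0 hV using hex
  refine ⟨fun z => V z.1 z.2, hV0, hV, fun q₀ hq₀ a b hab h0 => ?_, fun z hz => ?_⟩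
  · obtain ⟨R, hR⟩ := hR q₀ hq₀ a b hab h0
    obtain ⟨M, hM0, δ, hδ, hM⟩ := exists_forall_norm_le_near hf'c hq₀ hab R
    have hc : ContinuousWithinAt (fun q => ‖fderivWithin ℝ (fun q => u (q, t₀)) S q‖) S q₀ :=
      (hu₀.continuousOn_fderivWithin hSu (by simp) q₀ hq₀).norm
    have hba : 0 ≤ b - a := by linarith [h0.1, h0.2]
    set C := ‖fderivWithin ℝ (fun q => u (q, t₀)) S q₀‖ + 1 with hC
    refine ⟨(C + M * (b - a)) * Real.exp (M * (b - a)), ?_⟩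
    filter_upwards [hR, hc.eventually_lt_const (u := C) (lt_add_one _), self_mem_nhdsWithin,
      mem_nhdsWithin_of_mem_nhds (Metric.ball_mem_nhds q₀ hδ)] with q hq hqC hqS hqδ t ht
    have key := norm_le_of_hasDerivWithinAt_Icc (w := V q) h0 hM0 hM0
      (fun s hs => (hV q hqS s (hab hs)).mono hab)
      (fun s hs => by
        refine (ContinuousLinearMap.opNorm_comp_le _ _).trans ?_
        calc _ ≤ M * (‖V q s‖ + 1) :=
              mul_le_mul (hM q ⟨hqS, hqδ⟩ s hs _ (by simpa using hq s hs))
                (norm_variationMap_le _) (norm_nonneg _) hM0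
          _ = M * ‖V q s‖ + M := by ring) t ht
    refine key.trans ?_
    rw [hV0 q hqS]
    gcongr
  · obtain ⟨q₀, t₁⟩ := z
    refine hasFDerivWithinAt_solution (v := V q₀) hS hJ hf' hf'c hu ht₀ hz.1 (hR q₀ hz.1) ?_ hdu₀
      (fun t ht e => ?_) (fun t ht => (hV q₀ hz.1 t ht).continuousWithinAt) hz.2
    · rw [hV0 q₀ hz.1]
      exact (hdu₀ q₀ hz.1).hasFDerivWithinAt
    · have := (hV q₀ hz.1 t ht).clm_apply (hasDerivWithinAt_const t J e)
      simpa using this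

/-- The finite order version of `contDiffOn_solution`, for all systems at once: the induction step
applies the induction hypothesis to the system solved by the family together with its first
variation. -/
theorem contDiffOn_nat_solution [FiniteDimensional ℝ E] (hS : Convex ℝ S) (hSu : UniqueDiffOn ℝ S)
    (hJ : J.OrdConnected) (hJu : UniqueDiffOn ℝ J) (ht₀ : t₀ ∈ J) (k : ℕ) :
    ∀ {F : Type u} [NormedAddCommGroup F] [NormedSpace ℝ F] [FiniteDimensional ℝ F]
      {f : E × ℝ × F → F} {u : E × ℝ → F}, ContDiffOn ℝ ∞ f (S ×ˢ J ×ˢ univ) →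
      (∀ q ∈ S, ∀ t ∈ J, HasDerivWithinAt (fun s => u (q, s)) (f (q, t, u (q, t))) J t) →
      ContDiffOn ℝ ∞ (fun q => u (q, t₀)) S →
      (∀ q₀ ∈ S, ∀ a b, Icc a b ⊆ J → t₀ ∈ Icc a b →
        ∃ R, ∀ᶠ q in 𝓝[S] q₀, ∀ t ∈ Icc a b, ‖u (q, t)‖ ≤ R) →
      ContDiffOn ℝ k u (S ×ˢ J) := by
  induction k with
  | zero =>
    intro F _ _ _ f u hf hu hu₀ hR
    obtain ⟨v, -, -, -, hv⟩ := exists_variation hS hSu hJ hJu ht₀ hf hu hu₀ hR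
    exact contDiffOn_zero.2 fun z hz => (hv z hz).continuousWithinAt
  | succ k ih =>
    intro F _ _ _ f u hf hu hu₀ hR
    obtain ⟨v, hv0, hv, hvR, huv⟩ := exists_variation hS hSu hJ hJu ht₀ hf hu hu₀ hR
    have hΩ : UniqueDiffOn ℝ (S ×ˢ J ×ˢ (univ : Set F)) := hSu.prod (hJu.prod uniqueDiffOn_univ)
    have hf' := hf.fderivWithin (m := ∞) hΩ (by simp)
    -- `(u, v)` solves a system of the same kind, with the linearized equation as second component
    have hpair : ContDiffOn ℝ k (fun z => (u z, v z)) (S ×ˢ J) := by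
      refine ih (f := fun z : E × ℝ × (F × (E →L[ℝ] F)) => (f (z.1, z.2.1, z.2.2.1),
        (fderivWithin ℝ f (S ×ˢ J ×ˢ univ) (z.1, z.2.1, z.2.2.1)).comp
          (variationMap z.2.2.2))) ?_ (fun q hq t ht => (hu q hq t ht).prodMk (hv q hq t ht))
        ?_ (fun q₀ hq₀ a b hab h0 => ?_)
      · have hproj : ContDiffOn ℝ ∞
            (fun z : E × ℝ × (F × (E →L[ℝ] F)) => (z.1, z.2.1, z.2.2.1)) (S ×ˢ J ×ˢ univ) := by
          fun_prop
        refine (hf.comp hproj fun z hz => ⟨hz.1, hz.2.1, trivial⟩).prodMk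
          ((hf'.comp hproj fun z hz => ⟨hz.1, hz.2.1, trivial⟩).clm_comp
            (contDiff_variationMap.comp_contDiffOn (by fun_prop)))
      · refine hu₀.prodMk ((hu₀.fderivWithin (m := ∞) hSu (by simp)).congr hv0)
      · obtain ⟨R₁, h1⟩ := hR q₀ hq₀ a b hab h0
        obtain ⟨R₂, h2⟩ := hvR q₀ hq₀ a b hab h0
        refine ⟨max R₁ R₂, ?_⟩
        filter_upwards [h1, h2] with q h1 h2 t ht
        exact max_le_max (h1 t ht) (h2 t ht)
    have hUJ : UniqueDiffOn ℝ (S ×ˢ J) := hSu.prod hJu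
    have hu_k : ContDiffOn ℝ k u (S ×ˢ J) := hpair.fst
    have hv_k : ContDiffOn ℝ k v (S ×ˢ J) := hpair.snd
    push_cast
    rw [contDiffOn_succ_iff_hasFDerivWithinAt_of_uniqueDiffOn hUJ]
    refine ⟨by simp, _, ?_, huv⟩
    have hfu : ContDiffOn ℝ k (fun z : E × ℝ => f (z.1, z.2, u z)) (S ×ˢ J) :=
      (hf.of_le (by exact_mod_cast le_top)).comp (by fun_prop) fun z hz => ⟨hz.1, hz.2, trivial⟩
    have hspan : ContDiffOn ℝ k (fun z : E × ℝ =>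
        ContinuousLinearMap.toSpanSingleton ℝ (f (z.1, z.2, u z))) (S ×ˢ J) :=
      (ContinuousLinearMap.toSpanSingletonCLE (𝕜 := ℝ) (E := F)).contDiff.comp_contDiffOn hfu
    have hcoprod : ∀ z : E × ℝ, (v z).coprod (ContinuousLinearMap.toSpanSingleton ℝ
        (f (z.1, z.2, u z))) = (v z).comp (ContinuousLinearMap.fst ℝ E ℝ) +
        (ContinuousLinearMap.toSpanSingleton ℝ (f (z.1, z.2, u z))).comp
          (ContinuousLinearMap.snd ℝ E ℝ) := fun z => by ext <;> simp
    simp only [hcoprod]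
    exact (hv_k.clm_comp contDiffOn_const).add (hspan.clm_comp contDiffOn_const)

/-- Smooth dependence on parameters: a locally bounded family of solutions of `∂ₜ u = f(q, t, u)`
is smooth in `(q, t)`, up to the boundary of the parameter set and of the time interval. -/
theorem contDiffOn_solution [FiniteDimensional ℝ E] (hS : Convex ℝ S) (hSu : UniqueDiffOn ℝ S)
    (hJ : J.OrdConnected) (hJu : UniqueDiffOn ℝ J) (ht₀ : t₀ ∈ J)
    {F : Type u} [NormedAddCommGroup F] [NormedSpace ℝ F] [FiniteDimensional ℝ F]
    {f : E × ℝ × F → F} {u : E × ℝ → F} (hf : ContDiffOn ℝ ∞ f (S ×ˢ J ×ˢ univ))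
    (hu : ∀ q ∈ S, ∀ t ∈ J, HasDerivWithinAt (fun s => u (q, s)) (f (q, t, u (q, t))) J t)
    (hu₀ : ContDiffOn ℝ ∞ (fun q => u (q, t₀)) S)
    (hR : ∀ q₀ ∈ S, ∀ a b, Icc a b ⊆ J → t₀ ∈ Icc a b →
      ∃ R, ∀ᶠ q in 𝓝[S] q₀, ∀ t ∈ Icc a b, ‖u (q, t)‖ ≤ R) :
    ContDiffOn ℝ ∞ u (S ×ˢ J) :=
  contDiffOn_infty.2 fun k => contDiffOn_nat_solution hS hSu hJ hJu ht₀ k hf hu hu₀ hR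

omit [NormedSpace ℝ E] in
/-- Local boundedness of a family of solutions, from an affine growth bound. -/
theorem exists_eventually_norm_solution_le {F : Type*} [NormedAddCommGroup F] [NormedSpace ℝ F]
    {f : E × ℝ × F → F} {u : E × ℝ → F} {q₀ : E} (hq₀ : q₀ ∈ S) {a b : ℝ} (hab : Icc a b ⊆ J)
    (h0 : t₀ ∈ Icc a b)
    (hu : ∀ q ∈ S, ∀ t ∈ J, HasDerivWithinAt (fun s => u (q, s)) (f (q, t, u (q, t))) J t)
    (hu₀ : ContinuousOn (fun q => u (q, t₀)) S) {M : ℝ} (hM0 : 0 ≤ M)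
    (hM : ∀ᶠ q in 𝓝[S] q₀, ∀ t ∈ Icc a b, ∀ x, ‖f (q, t, x)‖ ≤ M * ‖x‖ + M) :
    ∃ R, ∀ᶠ q in 𝓝[S] q₀, ∀ t ∈ Icc a b, ‖u (q, t)‖ ≤ R := by
  have hba : 0 ≤ b - a := by linarith [h0.1, h0.2]
  refine ⟨(‖u (q₀, t₀)‖ + 1 + M * (b - a)) * Real.exp (M * (b - a)), ?_⟩
  filter_upwards [hM, (hu₀ q₀ hq₀).norm.eventually_lt_const (lt_add_one _),
    self_mem_nhdsWithin] with q hq hqC hqS t ht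
  have key := norm_le_of_hasDerivWithinAt_Icc (w := fun t => u (q, t)) h0 hM0 hM0
    (fun s hs => (hu q hqS s (hab hs)).mono hab) (fun s hs => hq s hs _) t ht
  refine key.trans ?_
  gcongr

end SmoothDependence

/-! ### Periodic solutions of linear systems with parameters -/

section LinearSystems

universe u

variable {E : Type u} [NormedAddCommGroup E] [NormedSpace ℝ E]

theorem exists_lipschitzWith_affine {F : Type*} [NormedAddCommGroup F] [NormedSpace ℝ F]
    {A : ℝ → F →L[ℝ] F} {g : ℝ → F} {J : Set ℝ} (hA : ContinuousOn A J) (a b : ℝ)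
    (hab : Icc a b ⊆ J) : ∃ K : ℝ≥0, ∀ t ∈ Icc a b, LipschitzWith K (fun x => A t x + g t) := by
  obtain ⟨K, hK⟩ := isCompact_Icc.exists_bound_of_continuousOn (hA.mono hab)
  refine ⟨K.toNNReal, fun t ht => LipschitzWith.of_dist_le_mul fun x y => ?_⟩
  rw [dist_eq_norm, dist_eq_norm, add_sub_add_right_eq_sub, ← map_sub]
  exact (A t).le_of_opNorm_le ((hK t ht).trans (Real.le_coe_toNNReal K)) _

variable {F : Type u} [NormedAddCommGroup F] [NormedSpace ℝ F] {S : Set E}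

theorem exists_contDiffOn_linear_solution [FiniteDimensional ℝ E] [FiniteDimensional ℝ F]
    (hS : Convex ℝ S) (hSu : UniqueDiffOn ℝ S)
    {A : E × ℝ → F →L[ℝ] F} {g : E × ℝ → F} {x₀ : E → F}
    (hA : ContDiffOn ℝ ∞ A (S ×ˢ univ)) (hg : ContDiffOn ℝ ∞ g (S ×ˢ univ))
    (hx₀ : ContDiffOn ℝ ∞ x₀ S) :
    ∃ u : E × ℝ → F, ContDiffOn ℝ ∞ u (S ×ˢ univ) ∧ ∀ q ∈ S, u (q, 0) = x₀ q ∧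
      ∀ t, HasDerivAt (fun s => u (q, s)) (A (q, t) (u (q, t)) + g (q, t)) t := by
  have hAq : ∀ q ∈ S, ContinuousOn (fun t => A (q, t)) univ := fun q hq =>
    hA.continuousOn.comp (by fun_prop) fun t _ => ⟨hq, trivial⟩
  have hgq : ∀ q ∈ S, ContinuousOn (fun t => g (q, t)) univ := fun q hq =>
    hg.continuousOn.comp (by fun_prop) fun t _ => ⟨hq, trivial⟩
  have hex : ∀ q ∈ S, ∃ v : ℝ → F, v 0 = x₀ q ∧
      ∀ t ∈ univ, HasDerivWithinAt v (A (q, t) (v t) + g (q, t)) univ t := fun q hq =>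
    exists_hasDerivWithinAt (f := fun t x => A (q, t) x + g (q, t)) ordConnected_univ
      (mem_univ 0) (fun x => ((hAq q hq).clm_apply continuousOn_const).add (hgq q hq))
      (exists_lipschitzWith_affine (hAq q hq)) _
  choose! v hv0 hv using hex
  refine ⟨fun z => v z.1 z.2, ?_, fun q hq => ⟨hv0 q hq, fun t => by simpa using hv q hq t⟩⟩
  refine contDiffOn_solution (t₀ := 0)
    (f := fun z : E × ℝ × F => A (z.1, z.2.1) z.2.2 + g (z.1, z.2.1)) hS hSu ordConnected_univ
    uniqueDiffOn_univ (mem_univ 0) ?_ hv (hx₀.congr hv0) (fun q₀ hq₀ a b hab h0 => ?_)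
  · have hproj : ContDiffOn ℝ ∞ (fun z : E × ℝ × F => (z.1, z.2.1)) (S ×ˢ univ ×ˢ univ) := by
      fun_prop
    have hmaps : MapsTo (fun z : E × ℝ × F => (z.1, z.2.1)) (S ×ˢ univ ×ˢ univ) (S ×ˢ univ) :=
      fun z hz => ⟨hz.1, trivial⟩
    exact ((hA.comp hproj hmaps).clm_apply (by fun_prop)).add (hg.comp hproj hmaps)
  · have hproj : ContinuousOn (fun z : E × ℝ × F => (z.1, z.2.1)) (S ×ˢ univ ×ˢ univ) := by
      fun_prop
    have hmaps : MapsTo (fun z : E × ℝ × F => (z.1, z.2.1)) (S ×ˢ univ ×ˢ univ) (S ×ˢ univ) :=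
      fun z hz => ⟨hz.1, trivial⟩
    obtain ⟨M₁, hM₁0, δ₁, hδ₁, hM₁⟩ := exists_forall_norm_le_near (F := F)
      (hA.continuousOn.comp hproj hmaps) hq₀ hab 0
    obtain ⟨M₂, hM₂0, δ₂, hδ₂, hM₂⟩ := exists_forall_norm_le_near (F := F)
      (hg.continuousOn.comp hproj hmaps) hq₀ hab 0
    refine exists_eventually_norm_solution_le (u := fun z => v z.1 z.2)
      (f := fun z : E × ℝ × F => A (z.1, z.2.1) z.2.2 + g (z.1, z.2.1)) hq₀ hab h0 hv
      (hx₀.continuousOn.congr hv0) (le_max_of_le_left hM₁0 : 0 ≤ max M₁ M₂) ?_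
    filter_upwards [self_mem_nhdsWithin, mem_nhdsWithin_of_mem_nhds (Metric.ball_mem_nhds q₀ hδ₁),
      mem_nhdsWithin_of_mem_nhds (Metric.ball_mem_nhds q₀ hδ₂)] with q hqS hq1 hq2 t ht x
    refine (norm_add_le _ _).trans (add_le_add ?_ ?_)
    · refine (A (q, t)).le_of_opNorm_le (le_trans ?_ (le_max_left _ _)) x
      exact hM₁ q ⟨hqS, hq1⟩ t ht 0 (by simp)
    · exact (hM₂ q ⟨hqS, hq2⟩ t ht 0 (by simp)).trans (le_max_right _ _)

theorem linear_solution_ext {A : ℝ → F →L[ℝ] F} {g : ℝ → F} (hA : Continuous A) {u v : ℝ → F}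
    (hu : ∀ t, HasDerivAt u (A t (u t) + g t) t) (hv : ∀ t, HasDerivAt v (A t (v t) + g t) t)
    (h0 : u 0 = v 0) : u = v := by
  funext t
  exact eqOn_of_hasDerivWithinAt ordConnected_univ (mem_univ 0)
    (exists_lipschitzWith_affine hA.continuousOn) (fun t _ => by simpa using hu t)
    (fun t _ => by simpa using hv t) h0 (mem_univ t)

theorem linear_solution_periodic {A : ℝ → F →L[ℝ] F} {g : ℝ → F} (hA : Continuous A) {T : ℝ}
    (hAT : Function.Periodic A T) (hgT : Function.Periodic g T) {u : ℝ → F}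
    (hu : ∀ t, HasDerivAt u (A t (u t) + g t) t) (h0 : u T = u 0) : Function.Periodic u T := by
  have h1 : ∀ t, HasDerivAt (fun s => u (s + T)) (A t (u (t + T)) + g t) t := fun t => by
    have := (hu (t + T)).comp_add_const t T
    rwa [hAT, hgT] at this
  exact fun t => congrFun (linear_solution_ext hA h1 hu (by simpa using h0)) t

/-- If the homogeneous system has no periodic solution but `0`, then the inhomogeneous system has
a periodic solution, and it depends smoothly on parameters. With `U` the fundamental solution and
`z` the solution with `z (0) = 0`, the initial value is `(1 - U (T))⁻¹ z (T)`. -/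
theorem exists_contDiffOn_periodic_solution [FiniteDimensional ℝ E] [FiniteDimensional ℝ F]
    (hS : Convex ℝ S) (hSu : UniqueDiffOn ℝ S) {T : ℝ}
    {A : E × ℝ → F →L[ℝ] F} {g : E × ℝ → F}
    (hA : ContDiffOn ℝ ∞ A (S ×ˢ univ)) (hg : ContDiffOn ℝ ∞ g (S ×ˢ univ))
    (hAT : ∀ q ∈ S, Function.Periodic (fun t => A (q, t)) T)
    (hgT : ∀ q ∈ S, Function.Periodic (fun t => g (q, t)) T)
    (hker : ∀ q ∈ S, ∀ y : ℝ → F, (∀ t, HasDerivAt y (A (q, t) (y t)) t) →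
      Function.Periodic y T → y 0 = 0) :
    ∃ y : E × ℝ → F, ContDiffOn ℝ ∞ y (S ×ˢ univ) ∧ ∀ q ∈ S,
      Function.Periodic (fun t => y (q, t)) T ∧
      ∀ t, HasDerivAt (fun s => y (q, s)) (A (q, t) (y (q, t)) + g (q, t)) t := by
  obtain ⟨z, hz, hzq⟩ := exists_contDiffOn_linear_solution hS hSu hA hg (x₀ := fun _ => 0)
    contDiffOn_const
  obtain ⟨U, hU, hUq⟩ := exists_contDiffOn_linear_solution (F := F →L[ℝ] F) hS hSu
    (A := fun z => ContinuousLinearMap.compL ℝ F F F (A z)) (g := fun _ => 0) (x₀ := fun _ => 1)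
    ((ContinuousLinearMap.compL ℝ F F F).contDiff.comp_contDiffOn hA) contDiffOn_const
    contDiffOn_const
  have hAc : ∀ q ∈ S, Continuous (fun t => A (q, t)) := fun q hq => by
    rw [← continuousOn_univ]
    exact hA.continuousOn.comp (by fun_prop) fun t _ => ⟨hq, trivial⟩
  have hUx : ∀ q ∈ S, ∀ x : F, ∀ t,
      HasDerivAt (fun s => U (q, s) x) (A (q, t) (U (q, t) x)) t := fun q hq x t => by
    have := ((hUq q hq).2 t).clm_apply (hasDerivAt_const t x)
    simpa using this
  have hunit : ∀ q ∈ S, IsUnit (1 - U (q, T)) := fun q hq => by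
    have hinj : Function.Injective (1 - U (q, T) : F →L[ℝ] F) := by
      rw [injective_iff_map_eq_zero]
      intro x hx
      have hx' : U (q, T) x = U (q, 0) x := by
        rw [(hUq q hq).1]
        have : x - U (q, T) x = 0 := by simpa using hx
        simpa using (sub_eq_zero.1 this).symm
      have hper := linear_solution_periodic (g := fun _ => 0) (hAc q hq) (hAT q hq)
        (fun _ => rfl) (u := fun s => U (q, s) x) (fun t => by simpa using hUx q hq x t) hx'
      simpa [(hUq q hq).1] using hker q hq _ (hUx q hq x) hper
    rw [ContinuousLinearMap.isUnit_iff_bijective]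
    exact ⟨hinj, (LinearMap.injective_iff_surjective
      (f := ((1 - U (q, T) : F →L[ℝ] F) : F →ₗ[ℝ] F))).1 hinj⟩
  have hinv : ContDiffOn ℝ ∞ (fun q => Ring.inverse (1 - U (q, T))) S := by
    have h1 : ContDiffOn ℝ ∞ (fun q => 1 - U (q, T)) S :=
      contDiffOn_const.sub (hU.comp (by fun_prop) fun q hq => ⟨hq, trivial⟩)
    intro q hq
    obtain ⟨w, hw⟩ := hunit q hq
    have h2 := contDiffAt_ringInverse ℝ (n := ∞) w
    rw [hw] at h2
    exact h2.comp_contDiffWithinAt q (h1 q hq)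
  have hy₀ : ContDiffOn ℝ ∞ (fun q => Ring.inverse (1 - U (q, T)) (z (q, T))) S :=
    hinv.clm_apply (hz.comp (by fun_prop) fun q hq => ⟨hq, trivial⟩)
  refine ⟨fun p => U p (Ring.inverse (1 - U (p.1, T)) (z (p.1, T))) + z p, ?_, fun q hq => ?_⟩
  · exact (hU.clm_apply (hy₀.comp contDiffOn_fst fun p hp => hp.1)).add hz
  · have hode : ∀ t, HasDerivAt
        (fun s => U (q, s) (Ring.inverse (1 - U (q, T)) (z (q, T))) + z (q, s))
        (A (q, t) (U (q, t) (Ring.inverse (1 - U (q, T)) (z (q, T))) + z (q, t)) + g (q, t)) t := by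
      intro t
      rw [map_add, add_assoc]
      exact (hUx q hq _ t).add ((hzq q hq).2 t)
    refine ⟨linear_solution_periodic (hAc q hq) (hAT q hq) (hgT q hq) hode ?_, hode⟩
    have h1 : (1 - U (q, T)) (Ring.inverse (1 - U (q, T)) (z (q, T))) = z (q, T) := by
      have := Ring.mul_inverse_cancel _ (hunit q hq)
      calc _ = ((1 - U (q, T)) * Ring.inverse (1 - U (q, T))) (z (q, T)) := rfl
        _ = _ := by rw [this]; rfl
    beta_reduce
    rw [(hUq q hq).1, (hzq q hq).1, add_zero]
    simp only [sub_apply, one_apply_eq_self] at h1 ⊢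
    rw [← sub_eq_iff_eq_add'.1 h1]

end LinearSystems

/-! ### The arc length derivative along a periodic curve -/

section ArcLength

variable {V : Type*} [NormedAddCommGroup V] [NormedSpace ℝ V]

/-- The arc length derivative `D_s f = f' / |γ'|` along a curve `γ` on the line. A curve on the
circle is handled through its periodic lift `θ ↦ c (exp (i θ))`. -/
def arcDerivLift (γ : ℝ → Plane) (f : ℝ → V) (θ : ℝ) : V := ‖deriv γ θ‖⁻¹ • deriv f θ

/-- The operator `L_{n,γ}` of the Sobolev metric, for lifts. -/
def sobolevOpLift (A : ℝ) (n : ℕ) (γ h : ℝ → Plane) (θ : ℝ) : Plane :=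
  h θ + ((-1) ^ n * A) • ((arcDerivLift γ)^[2 * n] h) θ

/-- A smooth periodic curve with nowhere vanishing velocity. -/
structure IsPeriodicImmersion (T : ℝ) (γ : ℝ → Plane) : Prop where
  contDiff : ContDiff ℝ ∞ γ
  periodic : Function.Periodic γ T
  deriv_ne_zero : ∀ θ, deriv γ θ ≠ 0

theorem _root_.Function.Periodic.deriv {f : ℝ → V} {T : ℝ} (hf : Function.Periodic f T) :
    Function.Periodic (deriv f) T := fun θ => by
  rw [← deriv_comp_add_const, show (fun x => f (x + T)) = f from funext hf]

variable {T : ℝ} {γ : ℝ → Plane}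

theorem contDiff_deriv {f : ℝ → V} (hf : ContDiff ℝ ∞ f) : ContDiff ℝ ∞ (deriv f) :=
  (contDiff_infty_iff_deriv.1 hf).2

theorem IsPeriodicImmersion.contDiff_norm_deriv (hγ : IsPeriodicImmersion T γ) :
    ContDiff ℝ ∞ fun θ => ‖deriv γ θ‖ :=
  (contDiff_deriv hγ.contDiff).norm ℝ hγ.deriv_ne_zero

theorem IsPeriodicImmersion.norm_deriv_pos (hγ : IsPeriodicImmersion T γ) (θ : ℝ) :
    0 < ‖deriv γ θ‖ := norm_pos_iff.2 (hγ.deriv_ne_zero θ)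

theorem IsPeriodicImmersion.contDiff_arcDerivLift (hγ : IsPeriodicImmersion T γ) {f : ℝ → V}
    (hf : ContDiff ℝ ∞ f) : ContDiff ℝ ∞ (arcDerivLift γ f) :=
  (hγ.contDiff_norm_deriv.inv fun θ => (hγ.norm_deriv_pos θ).ne').smul (contDiff_deriv hf)

theorem IsPeriodicImmersion.contDiff_iterate (hγ : IsPeriodicImmersion T γ) {f : ℝ → V}
    (hf : ContDiff ℝ ∞ f) (m : ℕ) : ContDiff ℝ ∞ ((arcDerivLift γ)^[m] f) := by
  induction m with
  | zero => exact hf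
  | succ m ih => rw [Function.iterate_succ_apply']; exact hγ.contDiff_arcDerivLift ih

theorem IsPeriodicImmersion.periodic_arcDerivLift (hγ : IsPeriodicImmersion T γ) {f : ℝ → V}
    (hf : Function.Periodic f T) : Function.Periodic (arcDerivLift γ f) T := fun θ => by
  rw [arcDerivLift, arcDerivLift, hγ.periodic.deriv, hf.deriv]

theorem IsPeriodicImmersion.periodic_iterate (hγ : IsPeriodicImmersion T γ) {f : ℝ → V}
    (hf : Function.Periodic f T) (m : ℕ) : Function.Periodic ((arcDerivLift γ)^[m] f) T := by
  induction m with
  | zero => exact hf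
  | succ m ih => rw [Function.iterate_succ_apply']; exact hγ.periodic_arcDerivLift ih

theorem IsPeriodicImmersion.norm_smul_arcDerivLift (hγ : IsPeriodicImmersion T γ) (f : ℝ → V)
    (θ : ℝ) : ‖deriv γ θ‖ • arcDerivLift γ f θ = deriv f θ := by
  rw [arcDerivLift, smul_inv_smul₀ (hγ.norm_deriv_pos θ).ne']

theorem arcDerivLift_add {f g : ℝ → V} (hf : Differentiable ℝ f) (hg : Differentiable ℝ g) :
    arcDerivLift γ (f + g) = arcDerivLift γ f + arcDerivLift γ g := by
  ext1 θ
  simp [arcDerivLift, deriv_add (hf θ) (hg θ)]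

theorem IsPeriodicImmersion.iterate_add (hγ : IsPeriodicImmersion T γ) {f g : ℝ → V}
    (hf : ContDiff ℝ ∞ f) (hg : ContDiff ℝ ∞ g) (m : ℕ) :
    (arcDerivLift γ)^[m] (f + g) = (arcDerivLift γ)^[m] f + (arcDerivLift γ)^[m] g := by
  induction m with
  | zero => rfl
  | succ m ih =>
    simp only [Function.iterate_succ_apply']
    rw [ih, arcDerivLift_add ((hγ.contDiff_iterate hf m).differentiable (by simp))
      ((hγ.contDiff_iterate hg m).differentiable (by simp))]

theorem arcDerivLift_smul {a : ℝ → ℝ} {f : ℝ → V} {θ : ℝ} (ha : DifferentiableAt ℝ a θ)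
    (hf : DifferentiableAt ℝ f θ) :
    arcDerivLift γ (fun θ => a θ • f θ) θ = arcDerivLift γ a θ • f θ + a θ • arcDerivLift γ f θ := by
  simp only [arcDerivLift]
  rw [deriv_fun_smul ha hf, smul_add, smul_comm (a θ), smul_assoc, add_comm]

/-- The unit tangent vector. -/
def unitTangent (γ : ℝ → Plane) : ℝ → Plane := arcDerivLift γ γ

theorem IsPeriodicImmersion.norm_smul_unitTangent (hγ : IsPeriodicImmersion T γ) (θ : ℝ) :
    ‖deriv γ θ‖ • unitTangent γ θ = deriv γ θ := hγ.norm_smul_arcDerivLift γ θ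

theorem IsPeriodicImmersion.norm_unitTangent (hγ : IsPeriodicImmersion T γ) (θ : ℝ) :
    ‖unitTangent γ θ‖ = 1 := by
  rw [unitTangent, arcDerivLift, norm_smul, norm_inv, norm_norm,
    inv_mul_cancel₀ (hγ.norm_deriv_pos θ).ne']

theorem IsPeriodicImmersion.contDiff_unitTangent (hγ : IsPeriodicImmersion T γ) :
    ContDiff ℝ ∞ (unitTangent γ) := hγ.contDiff_arcDerivLift hγ.contDiff

theorem IsPeriodicImmersion.periodic_unitTangent (hγ : IsPeriodicImmersion T γ) :
    Function.Periodic (unitTangent γ) T := hγ.periodic_arcDerivLift hγ.periodic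

/-- The coefficients of Leibniz' rule
`D_s^m (a v) = ∑ i ≤ m, (D_s^i a) • leibnizCoeff γ m i` for `v` the unit tangent vector. -/
def leibnizCoeff (γ : ℝ → Plane) : ℕ → ℕ → ℝ → Plane
  | 0, 0 => unitTangent γ
  | 0, _ + 1 => fun _ => 0
  | m + 1, 0 => arcDerivLift γ (leibnizCoeff γ m 0)
  | m + 1, i + 1 => fun θ => arcDerivLift γ (leibnizCoeff γ m (i + 1)) θ + leibnizCoeff γ m i θ

theorem leibnizCoeff_of_lt (γ : ℝ → Plane) {m i : ℕ} (h : m < i) :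
    leibnizCoeff γ m i = fun _ => 0 := by
  induction m generalizing i with
  | zero => obtain ⟨i, rfl⟩ := Nat.exists_eq_succ_of_ne_zero h.ne'; rfl
  | succ m ih =>
    obtain ⟨i, rfl⟩ := Nat.exists_eq_succ_of_ne_zero (Nat.ne_zero_of_lt h)
    funext θ
    simp only [leibnizCoeff]
    rw [ih (by omega), ih (by omega)]
    simp [arcDerivLift]

theorem leibnizCoeff_self (γ : ℝ → Plane) (m : ℕ) : leibnizCoeff γ m m = unitTangent γ := by
  induction m with
  | zero => rfl
  | succ m ih =>
    funext θ
    simp only [leibnizCoeff]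
    rw [leibnizCoeff_of_lt γ (Nat.lt_succ_self m), ih]
    simp [arcDerivLift]

theorem IsPeriodicImmersion.contDiff_leibnizCoeff (hγ : IsPeriodicImmersion T γ) (m i : ℕ) :
    ContDiff ℝ ∞ (leibnizCoeff γ m i) := by
  induction m generalizing i with
  | zero =>
    cases i with
    | zero => exact hγ.contDiff_unitTangent
    | succ i => exact contDiff_const
  | succ m ih =>
    cases i with
    | zero => exact hγ.contDiff_arcDerivLift (ih 0)
    | succ i => exact (hγ.contDiff_arcDerivLift (ih (i + 1))).add (ih i)

theorem IsPeriodicImmersion.periodic_leibnizCoeff (hγ : IsPeriodicImmersion T γ) (m i : ℕ) :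
    Function.Periodic (leibnizCoeff γ m i) T := by
  induction m generalizing i with
  | zero =>
    cases i with
    | zero => exact hγ.periodic_unitTangent
    | succ i => exact fun _ => rfl
  | succ m ih =>
    cases i with
    | zero => exact hγ.periodic_arcDerivLift (ih 0)
    | succ i =>
      intro θ
      simp only [leibnizCoeff]
      rw [hγ.periodic_arcDerivLift (ih (i + 1)), ih i]

theorem IsPeriodicImmersion.iterate_smul_unitTangent (hγ : IsPeriodicImmersion T γ) {a : ℝ → ℝ}
    (ha : ContDiff ℝ ∞ a) (m : ℕ) (θ : ℝ) :
    ((arcDerivLift γ)^[m] fun θ => a θ • unitTangent γ θ) θ =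
      ∑ i ∈ Finset.range (m + 1), ((arcDerivLift γ)^[i] a) θ • leibnizCoeff γ m i θ := by
  induction m generalizing θ with
  | zero => simp [leibnizCoeff]
  | succ m ih =>
    have hd : ∀ i ∈ Finset.range (m + 1), DifferentiableAt ℝ
        (fun θ => ((arcDerivLift γ)^[i] a) θ • leibnizCoeff γ m i θ) θ := fun i _ =>
      (((hγ.contDiff_iterate ha i).smul (hγ.contDiff_leibnizCoeff m i)).differentiable
        (by simp)) θ
    rw [Function.iterate_succ_apply', funext ih, arcDerivLift, deriv_fun_sum hd, Finset.smul_sum]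
    have h1 : ∀ i ∈ Finset.range (m + 1),
        ‖deriv γ θ‖⁻¹ • deriv (fun θ => ((arcDerivLift γ)^[i] a) θ • leibnizCoeff γ m i θ) θ =
          ((arcDerivLift γ)^[i + 1] a) θ • leibnizCoeff γ m i θ +
            ((arcDerivLift γ)^[i] a) θ • arcDerivLift γ (leibnizCoeff γ m i) θ := fun i _ => by
      rw [Function.iterate_succ_apply']
      exact arcDerivLift_smul ((hγ.contDiff_iterate ha i).differentiable (by simp) θ)
        ((hγ.contDiff_leibnizCoeff m i).differentiable (by simp) θ)
    rw [Finset.sum_congr rfl h1, Finset.sum_add_distrib, Finset.sum_range_succ' _ (m + 1)]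
    simp only [leibnizCoeff, smul_add, Finset.sum_add_distrib]
    rw [Finset.sum_range_succ (fun i => ((arcDerivLift γ)^[i + 1] a) θ •
      arcDerivLift γ (leibnizCoeff γ m (i + 1)) θ), leibnizCoeff_of_lt γ (Nat.lt_succ_self m),
      Finset.sum_range_succ' (fun i => ((arcDerivLift γ)^[i] a) θ •
      arcDerivLift γ (leibnizCoeff γ m i) θ)]
    have h0 : arcDerivLift γ (fun _ => (0 : Plane)) θ = 0 := by simp [arcDerivLift]
    rw [h0]
    simp only [smul_zero]
    abel

/-- Integration by parts with respect to arc length, for periodic functions. -/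
theorem IsPeriodicImmersion.integral_iterate (hγ : IsPeriodicImmersion T γ) {h k : ℝ → Plane}
    (hh : ContDiff ℝ ∞ h) (hhT : Function.Periodic h T) (hk : ContDiff ℝ ∞ k)
    (hkT : Function.Periodic k T) (m : ℕ) :
    ∫ θ in (0 : ℝ)..T, ‖deriv γ θ‖ * inner ℝ (((arcDerivLift γ)^[m] h) θ) (k θ) =
      (-1) ^ m * ∫ θ in (0 : ℝ)..T, ‖deriv γ θ‖ * inner ℝ (h θ) (((arcDerivLift γ)^[m] k) θ) := by
  have hone : ∀ {f g : ℝ → Plane}, ContDiff ℝ ∞ f → Function.Periodic f T → ContDiff ℝ ∞ g →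
      Function.Periodic g T →
      ∫ θ in (0 : ℝ)..T, ‖deriv γ θ‖ * inner ℝ (arcDerivLift γ f θ) (g θ) =
        -∫ θ in (0 : ℝ)..T, ‖deriv γ θ‖ * inner ℝ (f θ) (arcDerivLift γ g θ) := by
    intro f g hf hfT hg hgT
    have hcont : ∀ {f g : ℝ → Plane}, ContDiff ℝ ∞ f → ContDiff ℝ ∞ g → IntervalIntegrable
        (fun θ => inner ℝ (f θ) (deriv g θ)) MeasureTheory.volume 0 T := fun hf hg =>
      (hf.continuous.inner (contDiff_deriv hg).continuous).intervalIntegrable _ _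
    have h1 : ∀ θ, HasDerivAt (fun θ => inner ℝ (f θ) (g θ))
        (inner ℝ (f θ) (deriv g θ) + inner ℝ (deriv f θ) (g θ)) θ := fun θ =>
      ((hf.differentiable (by simp)) θ).hasDerivAt.inner ℝ
        ((hg.differentiable (by simp)) θ).hasDerivAt
    have h2 := intervalIntegral.integral_eq_sub_of_hasDerivAt (a := 0) (b := T)
      (fun θ _ => h1 θ) ((hcont hf hg).add (by simpa only [real_inner_comm] using hcont hg hf))
    have hT0 : inner ℝ (f T) (g T) - inner ℝ (f 0) (g 0) = 0 := by
      rw [← zero_add T, hfT, hgT, sub_self]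
    rw [hT0, intervalIntegral.integral_add (hcont hf hg)
      (by simpa only [real_inner_comm] using hcont hg hf)] at h2
    have h3 : ∀ θ, ‖deriv γ θ‖ * inner ℝ (arcDerivLift γ f θ) (g θ) = inner ℝ (deriv f θ) (g θ) :=
      fun θ => by rw [← hγ.norm_smul_arcDerivLift f θ, real_inner_smul_left]
    have h4 : ∀ θ, ‖deriv γ θ‖ * inner ℝ (f θ) (arcDerivLift γ g θ) = inner ℝ (f θ) (deriv g θ) :=
      fun θ => by rw [← hγ.norm_smul_arcDerivLift g θ, real_inner_smul_right]
    simp only [h3, h4]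
    linarith
  induction m generalizing k with
  | zero => simp
  | succ m ih =>
    simp only [Function.iterate_succ_apply']
    rw [hone (hγ.contDiff_iterate hh m) (hγ.periodic_iterate hhT m) hk hkT,
      ih (hγ.contDiff_arcDerivLift hk) (hγ.periodic_arcDerivLift hkT),
      ← Function.iterate_succ_apply, Function.iterate_succ_apply', pow_succ]
    ring

/-- The operator `a ↦ ⟨L (a v), v⟩` on functions, with `v` the unit tangent vector, has trivial
kernel: integrating the equation against `a` gives `∫ |a v|² + A |D_sⁿ (a v)|² ds = 0`. -/
theorem IsPeriodicImmersion.eq_zero_of_inner_sobolevOpLift_eq_zero (hγ : IsPeriodicImmersion T γ)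
    (hT : 0 < T) {A : ℝ} (hA : 0 < A) {n : ℕ} {a : ℝ → ℝ} (ha : ContDiff ℝ ∞ a)
    (haT : Function.Periodic a T)
    (h : ∀ θ, inner ℝ (sobolevOpLift A n γ (fun θ => a θ • unitTangent γ θ) θ)
      (unitTangent γ θ) = 0) : a = 0 := by
  set f : ℝ → Plane := fun θ => a θ • unitTangent γ θ with hf
  have hfs : ContDiff ℝ ∞ f := ha.smul hγ.contDiff_unitTangent
  have hfT : Function.Periodic f T := fun θ => by
    simp only [hf]; rw [haT, hγ.periodic_unitTangent]
  have hρ : Continuous fun θ => ‖deriv γ θ‖ := hγ.contDiff_norm_deriv.continuous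
  have hDc : ∀ m, Continuous ((arcDerivLift γ)^[m] f) := fun m =>
    (hγ.contDiff_iterate hfs m).continuous
  have hpt : ∀ θ, ‖deriv γ θ‖ * inner ℝ (f θ) (f θ) +
      (-1) ^ n * A * (‖deriv γ θ‖ * inner ℝ (((arcDerivLift γ)^[2 * n] f) θ) (f θ)) = 0 := by
    intro θ
    have h1 : inner ℝ (f θ) (unitTangent γ θ) + (-1) ^ n * A *
        inner ℝ (((arcDerivLift γ)^[2 * n] f) θ) (unitTangent γ θ) = 0 := by
      rw [← real_inner_smul_left, ← inner_add_left]
      exact h θ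
    have h2 : ∀ x : Plane, inner ℝ x (f θ) = a θ * inner ℝ x (unitTangent γ θ) := fun x => by
      rw [hf]; exact real_inner_smul_right _ _ _
    rw [h2, h2]
    linear_combination ‖deriv γ θ‖ * a θ * h1
  have hint : ∫ θ in (0 : ℝ)..T, ‖deriv γ θ‖ * inner ℝ (((arcDerivLift γ)^[2 * n] f) θ) (f θ) =
      (-1) ^ n * ∫ θ in (0 : ℝ)..T, ‖deriv γ θ‖ *
        inner ℝ (((arcDerivLift γ)^[n] f) θ) (((arcDerivLift γ)^[n] f) θ) := by
    rw [two_mul]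
    simp only [Function.iterate_add_apply]
    exact hγ.integral_iterate (hγ.contDiff_iterate hfs n) (hγ.periodic_iterate hfT n) hfs hfT n
  have hsum : (∫ θ in (0 : ℝ)..T, ‖deriv γ θ‖ * inner ℝ (f θ) (f θ)) +
      A * ∫ θ in (0 : ℝ)..T, ‖deriv γ θ‖ *
        inner ℝ (((arcDerivLift γ)^[n] f) θ) (((arcDerivLift γ)^[n] f) θ) = 0 := by
    have h3 : ∫ θ in (0 : ℝ)..T, (‖deriv γ θ‖ * inner ℝ (f θ) (f θ) +
        (-1) ^ n * A * (‖deriv γ θ‖ * inner ℝ (((arcDerivLift γ)^[2 * n] f) θ) (f θ))) = 0 := by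
      simp only [hpt, intervalIntegral.integral_zero]
    have i1 : IntervalIntegrable (fun θ => ‖deriv γ θ‖ * inner ℝ (f θ) (f θ))
        MeasureTheory.volume 0 T :=
      (hρ.mul (hfs.continuous.inner hfs.continuous)).intervalIntegrable _ _
    have i2 : IntervalIntegrable (fun θ => (-1) ^ n * A * (‖deriv γ θ‖ *
        inner ℝ (((arcDerivLift γ)^[2 * n] f) θ) (f θ))) MeasureTheory.volume 0 T :=
      (continuous_const.mul (hρ.mul ((hDc _).inner hfs.continuous))).intervalIntegrable _ _
    rw [intervalIntegral.integral_add i1 i2, intervalIntegral.integral_const_mul, hint] at h3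
    have h4 : ((-1 : ℝ) ^ n) * (-1) ^ n = 1 := by rw [← mul_pow]; simp
    linear_combination h3 - (A * ∫ θ in (0 : ℝ)..T, ‖deriv γ θ‖ *
        inner ℝ (((arcDerivLift γ)^[n] f) θ) (((arcDerivLift γ)^[n] f) θ)) * h4
  have hn0 : 0 ≤ ∫ θ in (0 : ℝ)..T, ‖deriv γ θ‖ *
      inner ℝ (((arcDerivLift γ)^[n] f) θ) (((arcDerivLift γ)^[n] f) θ) :=
    intervalIntegral.integral_nonneg hT.le fun θ _ =>
      mul_nonneg (norm_nonneg _) real_inner_self_nonneg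
  have hle : ∫ θ in (0 : ℝ)..T, ‖deriv γ θ‖ * inner ℝ (f θ) (f θ) ≤ 0 := by
    have := mul_nonneg hA.le hn0
    linarith
  have hf0 : ∀ θ ∈ Icc 0 T, a θ = 0 := by
    intro θ hθ
    by_contra hne
    refine absurd hle (not_le.2 (intervalIntegral.integral_pos hT
      (hρ.mul (hfs.continuous.inner hfs.continuous)).continuousOn
      (fun x _ => mul_nonneg (norm_nonneg _) real_inner_self_nonneg) ⟨θ, hθ, ?_⟩))
    refine mul_pos (hγ.norm_deriv_pos θ) (real_inner_self_pos.2 (smul_ne_zero hne ?_))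
    rw [← norm_ne_zero_iff, hγ.norm_unitTangent]
    exact one_ne_zero
  funext θ
  obtain ⟨y, hy, hya⟩ := haT.exists_mem_Ico₀ hT θ
  rw [hya]
  exact hf0 y ⟨hy.1, hy.2.le⟩

end ArcLength

/-! ### The horizontality equation for the tangential component -/

section Companion

variable {T : ℝ} {γ : ℝ → Plane}

/-- The matrix of the equation `a + ε ⟨D_s^{m+1} (a v), v⟩ = r`, written as a first order system
for `y = (a, D_s a, …, D_s^m a)`; here `v` is the unit tangent vector of `γ`. -/
def companionMap (ε : ℝ) (m : ℕ) (γ : ℝ → Plane) (θ : ℝ) :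
    (Fin (m + 1) → ℝ) →L[ℝ] (Fin (m + 1) → ℝ) :=
  ContinuousLinearMap.pi (Fin.snoc (α := fun _ => (Fin (m + 1) → ℝ) →L[ℝ] ℝ)
    (fun i : Fin m => ‖deriv γ θ‖ • ContinuousLinearMap.proj (R := ℝ) (φ := fun _ => ℝ) i.succ)
    (-‖deriv γ θ‖ • (ε⁻¹ • ContinuousLinearMap.proj (R := ℝ) (φ := fun _ => ℝ) 0 +
      ∑ j : Fin (m + 1), inner ℝ (leibnizCoeff γ (m + 1) j θ) (unitTangent γ θ) •
        ContinuousLinearMap.proj (R := ℝ) (φ := fun _ => ℝ) j)))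

/-- The inhomogeneous term of the first order system for `a + ε ⟨D_s^{m+1} (a v), v⟩ = r`. -/
def companionInhom (ε : ℝ) (m : ℕ) (γ : ℝ → Plane) (r : ℝ → ℝ) (θ : ℝ) : Fin (m + 1) → ℝ :=
  Fin.snoc (α := fun _ => ℝ) (fun _ : Fin m => 0) (‖deriv γ θ‖ * (ε⁻¹ * r θ))

theorem companionMap_castSucc (ε : ℝ) (m : ℕ) (γ : ℝ → Plane) (θ : ℝ) (y : Fin (m + 1) → ℝ)
    (i : Fin m) : companionMap ε m γ θ y i.castSucc = ‖deriv γ θ‖ * y i.succ := by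
  simp [companionMap]

theorem companionMap_last (ε : ℝ) (m : ℕ) (γ : ℝ → Plane) (θ : ℝ) (y : Fin (m + 1) → ℝ) :
    companionMap ε m γ θ y (Fin.last m) = -‖deriv γ θ‖ * (ε⁻¹ * y 0 +
      ∑ j : Fin (m + 1), inner ℝ (leibnizCoeff γ (m + 1) j θ) (unitTangent γ θ) * y j) := by
  simp [companionMap, mul_add]

theorem IsPeriodicImmersion.periodic_companionMap (hγ : IsPeriodicImmersion T γ) (ε : ℝ) (m : ℕ) :
    Function.Periodic (companionMap ε m γ) T := fun θ => by
  simp only [companionMap, hγ.periodic.deriv θ, hγ.periodic_unitTangent θ,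
    fun i => hγ.periodic_leibnizCoeff (m + 1) i θ]

/-- The components of a solution of the companion system are the arc length derivatives of the
first component. -/
theorem IsPeriodicImmersion.iterate_arcDerivLift_eq (hγ : IsPeriodicImmersion T γ) {ε : ℝ}
    {m : ℕ} {r : ℝ → ℝ} {y : ℝ → Fin (m + 1) → ℝ}
    (hy : ∀ θ, HasDerivAt y (companionMap ε m γ θ (y θ) + companionInhom ε m γ r θ) θ)
    (i : Fin (m + 1)) (θ : ℝ) : ((arcDerivLift γ)^[i] fun θ => y θ 0) θ = y θ i := by
  induction i using Fin.induction generalizing θ with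
  | zero => rfl
  | succ i ih =>
    rw [Fin.val_succ, Function.iterate_succ_apply']
    have h1 := (hasDerivAt_pi.1 (hy θ) i.castSucc).deriv
    rw [Pi.add_apply, companionMap_castSucc] at h1
    simp only [companionInhom, Fin.snoc_castSucc, add_zero] at h1
    rw [show (arcDerivLift γ)^[(i : ℕ)] (fun θ => y θ 0) = fun θ => y θ i.castSucc from
      funext fun θ => by simpa using ih θ, arcDerivLift, h1, smul_eq_mul,
      inv_mul_cancel_left₀ (hγ.norm_deriv_pos θ).ne']

/-- A solution of the companion system yields a solution of the scalar equation of order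
`m + 1`. -/
theorem IsPeriodicImmersion.add_inner_iterate_eq (hγ : IsPeriodicImmersion T γ) {ε : ℝ}
    (hε : ε ≠ 0) {m : ℕ} {r : ℝ → ℝ} {y : ℝ → Fin (m + 1) → ℝ} (hys : ContDiff ℝ ∞ y)
    (hy : ∀ θ, HasDerivAt y (companionMap ε m γ θ (y θ) + companionInhom ε m γ r θ) θ) (θ : ℝ) :
    y θ 0 + ε * inner ℝ (((arcDerivLift γ)^[m + 1] fun θ => y θ 0 • unitTangent γ θ) θ)
      (unitTangent γ θ) = r θ := by
  have hρ := (hγ.norm_deriv_pos θ).ne'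
  have ha : ContDiff ℝ ∞ fun θ => y θ 0 := contDiff_pi.1 hys 0
  have htop : ((arcDerivLift γ)^[m + 1] fun θ => y θ 0) θ = ε⁻¹ * (r θ - y θ 0) -
      ∑ j : Fin (m + 1), inner ℝ (leibnizCoeff γ (m + 1) j θ) (unitTangent γ θ) * y θ j := by
    have h1 := (hasDerivAt_pi.1 (hy θ) (Fin.last m)).deriv
    rw [Pi.add_apply, companionMap_last] at h1
    simp only [companionInhom, Fin.snoc_last] at h1
    rw [Function.iterate_succ_apply', show (arcDerivLift γ)^[m] (fun θ => y θ 0) =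
      fun θ => y θ (Fin.last m) from funext fun θ => by
        simpa using hγ.iterate_arcDerivLift_eq hy (Fin.last m) θ, arcDerivLift, h1, smul_eq_mul]
    field_simp
    ring
  rw [hγ.iterate_smul_unitTangent ha, Finset.sum_range_succ, leibnizCoeff_self, inner_add_left,
    real_inner_smul_left, real_inner_self_eq_norm_sq, hγ.norm_unitTangent, htop, sum_inner,
    Finset.sum_range]
  have h2 : ∀ j : Fin (m + 1), inner ℝ ((((arcDerivLift γ)^[(j : ℕ)] fun θ => y θ 0) θ) •
      leibnizCoeff γ (m + 1) j θ) (unitTangent γ θ) =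
        inner ℝ (leibnizCoeff γ (m + 1) j θ) (unitTangent γ θ) * y θ j := fun j => by
    rw [real_inner_smul_left, hγ.iterate_arcDerivLift_eq hy j θ, mul_comm]
  rw [Finset.sum_congr rfl fun j _ => h2 j]
  field_simp
  ring

end Companion

section Families

variable {E : Type*} [NormedAddCommGroup E] [NormedSpace ℝ E] {S : Set E}

theorem contDiffOn_partial_derivWithin {V : Type*} [NormedAddCommGroup V] [NormedSpace ℝ V]
    {J : Set ℝ} (hS : UniqueDiffOn ℝ S) (hJ : UniqueDiffOn ℝ J) {f : E → ℝ → V}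
    (hf : ContDiffOn ℝ ∞ (fun z : E × ℝ => f z.1 z.2) (S ×ˢ J)) :
    ContDiffOn ℝ ∞ (fun z : E × ℝ => derivWithin (f z.1) J z.2) (S ×ˢ J) := by
  have h1 := (hf.fderivWithin (m := ∞) (hS.prod hJ) (by simp)).clm_apply
    (contDiffOn_const (c := ((0, 1) : E × ℝ)))
  refine h1.congr fun z hz => ?_
  have h2 := (hf.differentiableOn (by simp) z hz).hasFDerivWithinAt
  have h3 : HasDerivWithinAt (fun s : ℝ => (z.1, s)) ((0, 1) : E × ℝ) J z.2 :=
    (hasDerivWithinAt_const _ _ _).prodMk (hasDerivWithinAt_id _ _)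
  have hmaps : MapsTo (fun s : ℝ => (z.1, s)) J (S ×ˢ J) := fun s hs => ⟨hz.1, hs⟩
  exact (h2.comp_hasDerivWithinAt z.2 h3 hmaps).derivWithin (hJ z.2 hz.2)

theorem contDiffOn_partial_deriv {V : Type*} [NormedAddCommGroup V] [NormedSpace ℝ V]
    (hS : UniqueDiffOn ℝ S) {f : E → ℝ → V}
    (hf : ContDiffOn ℝ ∞ (fun z : E × ℝ => f z.1 z.2) (S ×ˢ univ)) :
    ContDiffOn ℝ ∞ (fun z : E × ℝ => deriv (f z.1) z.2) (S ×ˢ univ) := by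
  simpa only [derivWithin_univ] using contDiffOn_partial_derivWithin hS uniqueDiffOn_univ hf

/-- A smooth family of periodic immersions. -/
structure IsImmersionFamily (S : Set E) (T : ℝ) (γ : E → ℝ → Plane) : Prop where
  contDiffOn : ContDiffOn ℝ ∞ (fun z : E × ℝ => γ z.1 z.2) (S ×ˢ univ)
  immersion : ∀ q ∈ S, IsPeriodicImmersion T (γ q)

variable {T : ℝ} {γ : E → ℝ → Plane}

theorem IsImmersionFamily.contDiffOn_norm_deriv (hγ : IsImmersionFamily S T γ) (hS : UniqueDiffOn ℝ S) :
    ContDiffOn ℝ ∞ (fun z : E × ℝ => ‖deriv (γ z.1) z.2‖) (S ×ˢ univ) :=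
  (contDiffOn_partial_deriv hS hγ.contDiffOn).norm ℝ
    fun z hz => (hγ.immersion z.1 hz.1).deriv_ne_zero z.2

theorem IsImmersionFamily.contDiffOn_inv_norm_deriv (hγ : IsImmersionFamily S T γ) (hS : UniqueDiffOn ℝ S) :
    ContDiffOn ℝ ∞ (fun z : E × ℝ => ‖deriv (γ z.1) z.2‖⁻¹) (S ×ˢ univ) :=
  (hγ.contDiffOn_norm_deriv hS).inv fun z hz => ((hγ.immersion z.1 hz.1).norm_deriv_pos z.2).ne'

theorem IsImmersionFamily.contDiffOn_arcDerivLift {V : Type*} [NormedAddCommGroup V] [NormedSpace ℝ V]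
    (hγ : IsImmersionFamily S T γ) (hS : UniqueDiffOn ℝ S) {f : E → ℝ → V}
    (hf : ContDiffOn ℝ ∞ (fun z : E × ℝ => f z.1 z.2) (S ×ˢ univ)) :
    ContDiffOn ℝ ∞ (fun z : E × ℝ => arcDerivLift (γ z.1) (f z.1) z.2) (S ×ˢ univ) :=
  (hγ.contDiffOn_inv_norm_deriv hS).smul (contDiffOn_partial_deriv hS hf)

theorem IsImmersionFamily.contDiffOn_iterate {V : Type*} [NormedAddCommGroup V] [NormedSpace ℝ V]
    (hγ : IsImmersionFamily S T γ) (hS : UniqueDiffOn ℝ S) {f : E → ℝ → V}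
    (hf : ContDiffOn ℝ ∞ (fun z : E × ℝ => f z.1 z.2) (S ×ˢ univ)) (m : ℕ) :
    ContDiffOn ℝ ∞ (fun z : E × ℝ => ((arcDerivLift (γ z.1))^[m] (f z.1)) z.2)
      (S ×ˢ univ) := by
  induction m with
  | zero => exact hf
  | succ m ih =>
    simp only [Function.iterate_succ_apply']
    exact hγ.contDiffOn_arcDerivLift (f := fun q => (arcDerivLift (γ q))^[m] (f q)) hS ih

theorem IsImmersionFamily.contDiffOn_unitTangent (hγ : IsImmersionFamily S T γ) (hS : UniqueDiffOn ℝ S) :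
    ContDiffOn ℝ ∞ (fun z : E × ℝ => unitTangent (γ z.1) z.2) (S ×ˢ univ) :=
  hγ.contDiffOn_arcDerivLift hS hγ.contDiffOn

theorem IsImmersionFamily.contDiffOn_leibnizCoeff (hγ : IsImmersionFamily S T γ) (hS : UniqueDiffOn ℝ S)
    (m i : ℕ) :
    ContDiffOn ℝ ∞ (fun z : E × ℝ => leibnizCoeff (γ z.1) m i z.2) (S ×ˢ univ) := by
  induction m generalizing i with
  | zero =>
    cases i with
    | zero => exact hγ.contDiffOn_unitTangent hS
    | succ i => exact contDiffOn_const
  | succ m ih =>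
    cases i with
    | zero => exact hγ.contDiffOn_arcDerivLift (f := fun q => leibnizCoeff (γ q) m 0) hS (ih 0)
    | succ i => exact (hγ.contDiffOn_arcDerivLift (f := fun q => leibnizCoeff (γ q) m (i + 1)) hS (ih (i + 1))).add (ih i)

theorem IsImmersionFamily.contDiffOn_sobolevOpLift (hγ : IsImmersionFamily S T γ)
    (hS : UniqueDiffOn ℝ S) (A : ℝ) (n : ℕ) {h : E → ℝ → Plane}
    (hh : ContDiffOn ℝ ∞ (fun z : E × ℝ => h z.1 z.2) (S ×ˢ univ)) :
    ContDiffOn ℝ ∞ (fun z : E × ℝ => sobolevOpLift A n (γ z.1) (h z.1) z.2) (S ×ˢ univ) := by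
  have h1 := (hγ.contDiffOn_iterate hS hh (2 * n)).const_smul ((-1) ^ n * A)
  exact hh.add h1

theorem IsImmersionFamily.contDiffOn_companionMap [FiniteDimensional ℝ E] (hγ : IsImmersionFamily S T γ)
    (hS : UniqueDiffOn ℝ S) (ε : ℝ) (m : ℕ) :
    ContDiffOn ℝ ∞ (fun z : E × ℝ => companionMap ε m (γ z.1) z.2) (S ×ˢ univ) := by
  refine contDiffOn_clm_apply.2 fun y => contDiffOn_pi.2 fun i => ?_
  induction i using Fin.lastCases with
  | last =>
    simp only [companionMap_last]
    refine (hγ.contDiffOn_norm_deriv hS).neg.mul (contDiffOn_const.add (ContDiffOn.sum fun j _ => ?_))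
    exact ((hγ.contDiffOn_leibnizCoeff hS (m + 1) j).inner ℝ (hγ.contDiffOn_unitTangent hS)).mul contDiffOn_const
  | cast i =>
    simp only [companionMap_castSucc]
    exact (hγ.contDiffOn_norm_deriv hS).mul contDiffOn_const

theorem IsImmersionFamily.contDiffOn_companionInhom (hγ : IsImmersionFamily S T γ)
    (hS : UniqueDiffOn ℝ S) (ε : ℝ) (m : ℕ) {r : E → ℝ → ℝ}
    (hr : ContDiffOn ℝ ∞ (fun z : E × ℝ => r z.1 z.2) (S ×ˢ univ)) :
    ContDiffOn ℝ ∞ (fun z : E × ℝ => companionInhom ε m (γ z.1) (r z.1) z.2) (S ×ˢ univ) := by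
  refine contDiffOn_pi.2 fun i => ?_
  induction i using Fin.lastCases with
  | last =>
    simp only [companionInhom, Fin.snoc_last]
    exact (hγ.contDiffOn_norm_deriv hS).mul (contDiffOn_const.mul hr)
  | cast i =>
    simp only [companionInhom, Fin.snoc_castSucc]
    exact contDiffOn_const

end Families

section Horizontal

variable {E : Type} [NormedAddCommGroup E] [NormedSpace ℝ E] [FiniteDimensional ℝ E]
  {S : Set E} {T : ℝ} {γ : E → ℝ → Plane}

theorem contDiff_slice {E V : Type*} [NormedAddCommGroup E] [NormedSpace ℝ E]
    [NormedAddCommGroup V] [NormedSpace ℝ V] {S : Set E} {f : E → ℝ → V}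
    (hf : ContDiffOn ℝ ∞ (fun z : E × ℝ => f z.1 z.2) (S ×ˢ univ)) {q : E} (hq : q ∈ S) :
    ContDiff ℝ ∞ (f q) := by
  rw [← contDiffOn_univ]
  exact hf.comp (f := fun θ : ℝ => (q, θ)) (by fun_prop) fun θ _ => ⟨hq, trivial⟩

theorem IsPeriodicImmersion.sobolevOpLift_add {γ : ℝ → Plane} (hγ : IsPeriodicImmersion T γ)
    {h k : ℝ → Plane} (hh : ContDiff ℝ ∞ h) (hk : ContDiff ℝ ∞ k) (A : ℝ) (n : ℕ) (θ : ℝ) :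
    sobolevOpLift A n γ (h + k) θ = sobolevOpLift A n γ h θ + sobolevOpLift A n γ k θ := by
  simp only [sobolevOpLift, hγ.iterate_add hh hk, Pi.add_apply, smul_add]
  abel

theorem IsPeriodicImmersion.inner_sobolevOpLift_smul {γ : ℝ → Plane}
    (hγ : IsPeriodicImmersion T γ) (A : ℝ) (n : ℕ) (b : ℝ → ℝ) (θ : ℝ) :
    inner ℝ (sobolevOpLift A n γ (fun θ => b θ • unitTangent γ θ) θ) (unitTangent γ θ) =
      b θ + ((-1) ^ n * A) * inner ℝ
        (((arcDerivLift γ)^[2 * n] fun θ => b θ • unitTangent γ θ) θ) (unitTangent γ θ) := by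
  rw [sobolevOpLift, inner_add_left, real_inner_smul_left, real_inner_smul_left,
    real_inner_self_eq_norm_sq, hγ.norm_unitTangent, one_pow, mul_one]

theorem companionInhom_zero (ε : ℝ) (m : ℕ) (γ : ℝ → Plane) (θ : ℝ) :
    companionInhom ε m γ (fun _ => 0) θ = 0 := by
  funext i
  induction i using Fin.lastCases <;> simp [companionInhom]

/-- The homogeneous companion system has no periodic solution but `0`. -/
theorem IsImmersionFamily.companion_kernel (hγ : IsImmersionFamily S T γ)
    (hT : 0 < T) (hS : Convex ℝ S) (hSu : UniqueDiffOn ℝ S) {A : ℝ} (hA : 0 < A) {n m : ℕ}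
    (hm : 2 * n = m + 1) {q : E} (hq : q ∈ S) {y : ℝ → Fin (m + 1) → ℝ}
    (hy : ∀ θ, HasDerivAt y (companionMap ((-1) ^ n * A) m (γ q) θ (y θ)) θ)
    (hyT : Function.Periodic y T) : y 0 = 0 := by
  have hI := hγ.immersion q hq
  have hε : (-1) ^ n * A ≠ 0 := mul_ne_zero (pow_ne_zero _ (by norm_num)) hA.ne'
  have hMc := hγ.contDiffOn_companionMap hSu ((-1) ^ n * A) m
  -- the solution is smooth because the coefficients are
  obtain ⟨u, hu, huq⟩ := exists_contDiffOn_linear_solution hS hSu hMc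
    (g := fun _ => 0) (x₀ := fun _ => y 0) contDiffOn_const contDiffOn_const
  have hMq : Continuous (companionMap ((-1) ^ n * A) m (γ q)) :=
    (contDiff_slice (f := fun q θ => companionMap ((-1) ^ n * A) m (γ q) θ) hMc hq).continuous
  have hyu : y = fun θ => u (q, θ) := linear_solution_ext (g := fun _ => 0) hMq
    (fun θ => by simpa using hy θ) (huq q hq).2 (huq q hq).1.symm
  have hys : ContDiff ℝ ∞ y := by
    rw [hyu]; exact contDiff_slice (f := fun q θ => u (q, θ)) hu hq
  have hy' : ∀ θ, HasDerivAt y (companionMap ((-1) ^ n * A) m (γ q) θ (y θ) +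
      companionInhom ((-1) ^ n * A) m (γ q) (fun _ => 0) θ) θ := fun θ => by
    rw [companionInhom_zero, add_zero]; exact hy θ
  have hzero : (fun θ => y θ 0) = 0 := by
    refine hI.eq_zero_of_inner_sobolevOpLift_eq_zero hT hA (n := n) (contDiff_pi.1 hys 0)
      (fun θ => congrFun (hyT θ) 0) fun θ => ?_
    rw [hI.inner_sobolevOpLift_smul, hm]
    exact hI.add_inner_iterate_eq hε hys hy' θ
  funext i
  rw [← hI.iterate_arcDerivLift_eq hy' i 0, hzero]
  have h0 : ∀ k : ℕ, (arcDerivLift (γ q))^[k] (0 : ℝ → ℝ) = 0 := fun k =>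
    Function.iterate_fixed (funext fun θ => by simp [arcDerivLift]) k
  rw [h0]
  rfl

/-- The equation `⟨L (a v), v⟩ = r` on functions, with `v` the unit tangent vector, has a solution
that depends smoothly on parameters. -/
theorem IsImmersionFamily.exists_tangential_solution (hγ : IsImmersionFamily S T γ)
    (hT : 0 < T) (hS : Convex ℝ S) (hSu : UniqueDiffOn ℝ S) {A : ℝ} (hA : 0 < A) (n : ℕ)
    {r : E → ℝ → ℝ} (hr : ContDiffOn ℝ ∞ (fun z : E × ℝ => r z.1 z.2) (S ×ˢ univ))
    (hrT : ∀ q ∈ S, Function.Periodic (r q) T) :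
    ∃ a : E → ℝ → ℝ, ContDiffOn ℝ ∞ (fun z : E × ℝ => a z.1 z.2) (S ×ˢ univ) ∧
      ∀ q ∈ S, Function.Periodic (a q) T ∧ ∀ θ,
        inner ℝ (sobolevOpLift A n (γ q) (fun θ => a q θ • unitTangent (γ q) θ) θ)
          (unitTangent (γ q) θ) = r q θ := by
  rcases Nat.eq_zero_or_pos n with rfl | hn
  · -- for `n = 0` the operator is multiplication by `1 + A`
    refine ⟨fun q θ => (1 + A)⁻¹ * r q θ, contDiffOn_const.mul hr, fun q hq =>
      ⟨fun θ => by simp only [hrT q hq θ], fun θ => ?_⟩⟩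
    rw [(hγ.immersion q hq).inner_sobolevOpLift_smul]
    simp only [mul_zero, Function.iterate_zero, id_eq, real_inner_smul_left,
      real_inner_self_eq_norm_sq, (hγ.immersion q hq).norm_unitTangent, pow_zero, one_mul,
      one_pow, mul_one]
    have : 1 + A ≠ 0 := by positivity
    field_simp
  · obtain ⟨m, hm⟩ : ∃ m, 2 * n = m + 1 := ⟨2 * n - 1, by omega⟩
    have hε : (-1) ^ n * A ≠ 0 := mul_ne_zero (pow_ne_zero _ (by norm_num)) hA.ne'
    obtain ⟨y, hy, hyq⟩ := exists_contDiffOn_periodic_solution hS hSu (T := T)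
      (hγ.contDiffOn_companionMap hSu ((-1) ^ n * A) m)
      (hγ.contDiffOn_companionInhom hSu ((-1) ^ n * A) m hr)
      (fun q hq => (hγ.immersion q hq).periodic_companionMap _ m)
      (fun q hq θ => by
        simp only [companionInhom, (hγ.immersion q hq).periodic.deriv θ, hrT q hq θ])
      (fun q hq y hy hyT => hγ.companion_kernel hT hS hSu hA hm hq hy hyT)
    refine ⟨fun q θ => y (q, θ) 0, contDiffOn_pi.1 hy 0, fun q hq =>
      ⟨fun θ => congrFun ((hyq q hq).1 θ) 0, fun θ => ?_⟩⟩
    rw [(hγ.immersion q hq).inner_sobolevOpLift_smul, hm]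
    exact (hγ.immersion q hq).add_inner_iterate_eq hε
      (contDiff_slice (f := fun q θ => y (q, θ)) hy hq) (hyq q hq).2 θ

/-- `α γ'` is the tangential correction that makes the vector field `w` along `γ` horizontal: `α` is
a smooth periodic function for which `w + α γ'` is orthogonal to the tangent vectors `γ'` with respect to the Sobolev metric. -/
structure IsHorizontalLift (A : ℝ) (n : ℕ) (T : ℝ) (γ w : ℝ → Plane) (α : ℝ → ℝ) : Prop where
  contDiff : ContDiff ℝ ∞ α
  periodic : Function.Periodic α T
  inner_eq_zero : ∀ θ, inner ℝ (sobolevOpLift A n γ (fun θ => w θ + α θ • deriv γ θ) θ)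
    (deriv γ θ) = 0

/-- The tangential component of the difference of two horizontal lifts lies in the kernel of
`a ↦ ⟨L (a v), v⟩`. -/
theorem IsHorizontalLift.unique {A : ℝ} (hA : 0 < A) {n : ℕ} (hT : 0 < T) {γ w : ℝ → Plane}
    (hγ : IsPeriodicImmersion T γ) (hw : ContDiff ℝ ∞ w) {α β : ℝ → ℝ}
    (hα : IsHorizontalLift A n T γ w α) (hβ : IsHorizontalLift A n T γ w β) : α = β := by
  set a : ℝ → ℝ := fun θ => ‖deriv γ θ‖ * (α θ - β θ) with ha
  have hγ' : ContDiff ℝ ∞ (deriv γ) := contDiff_deriv hγ.contDiff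
  have has : ContDiff ℝ ∞ a := hγ.contDiff_norm_deriv.mul (hα.contDiff.sub hβ.contDiff)
  have h0 : a = 0 := by
    refine hγ.eq_zero_of_inner_sobolevOpLift_eq_zero hT hA (n := n) has
      (fun θ => by simp only [ha, hγ.periodic.deriv θ, hα.periodic θ, hβ.periodic θ]) fun θ => ?_
    have hsum : (fun θ => w θ + α θ • deriv γ θ) =
        (fun θ => w θ + β θ • deriv γ θ) + fun θ => a θ • unitTangent γ θ := by
      funext θ
      simp only [Pi.add_apply, ha]
      rw [add_assoc, mul_comm, mul_smul, hγ.norm_smul_unitTangent, ← add_smul]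
      congr 2
      ring
    have h1 := hα.inner_eq_zero θ
    have hwβ : ContDiff ℝ ∞ fun θ => w θ + β θ • deriv γ θ := hw.add (hβ.contDiff.smul hγ')
    have hav : ContDiff ℝ ∞ fun θ => a θ • unitTangent γ θ := has.smul hγ.contDiff_unitTangent
    rw [hsum, hγ.sobolevOpLift_add hwβ hav, inner_add_left, hβ.inner_eq_zero θ, zero_add,
      ← hγ.norm_smul_unitTangent θ, real_inner_smul_right] at h1
    exact (mul_eq_zero.1 h1).resolve_left (hγ.norm_deriv_pos θ).ne'
  funext θ
  have h2 : ‖deriv γ θ‖ * (α θ - β θ) = 0 := congrFun h0 θ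
  exact sub_eq_zero.1 ((mul_eq_zero.1 h2).resolve_left (hγ.norm_deriv_pos θ).ne')

/-- Horizontal lifts exist and depend smoothly on parameters: `α γ' = a v` with `a = |γ'| α`, and
`a` solves `⟨L (a v), v⟩ = -⟨L w, v⟩`. -/
theorem IsImmersionFamily.exists_horizontalLift (hγ : IsImmersionFamily S T γ)
    (hT : 0 < T) (hS : Convex ℝ S) (hSu : UniqueDiffOn ℝ S) {A : ℝ} (hA : 0 < A) (n : ℕ)
    {w : E → ℝ → Plane} (hw : ContDiffOn ℝ ∞ (fun z : E × ℝ => w z.1 z.2) (S ×ˢ univ))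
    (hwT : ∀ q ∈ S, Function.Periodic (w q) T) :
    ∃ α : E → ℝ → ℝ, ContDiffOn ℝ ∞ (fun z : E × ℝ => α z.1 z.2) (S ×ˢ univ) ∧
      ∀ q ∈ S, IsHorizontalLift A n T (γ q) (w q) (α q) := by
  obtain ⟨a, ha, haq⟩ := hγ.exists_tangential_solution hT hS hSu hA n
    (r := fun q θ => -inner ℝ (sobolevOpLift A n (γ q) (w q) θ) (unitTangent (γ q) θ))
    ((hγ.contDiffOn_sobolevOpLift hSu A n hw).inner ℝ (hγ.contDiffOn_unitTangent hSu)).neg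
    (fun q hq θ => by
      simp only [sobolevOpLift, hwT q hq θ, (hγ.immersion q hq).periodic_unitTangent θ,
        (hγ.immersion q hq).periodic_iterate (hwT q hq) (2 * n) θ])
  have hαs : ContDiffOn ℝ ∞ (fun z : E × ℝ => ‖deriv (γ z.1) z.2‖⁻¹ * a z.1 z.2) (S ×ˢ univ) :=
    (hγ.contDiffOn_inv_norm_deriv hSu).mul ha
  refine ⟨fun q θ => ‖deriv (γ q) θ‖⁻¹ * a q θ, hαs, fun q hq => ?_⟩
  have hI := hγ.immersion q hq
  refine ⟨contDiff_slice (f := fun q θ => ‖deriv (γ q) θ‖⁻¹ * a q θ) hαs hq, fun θ => by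
    simp only [hI.periodic.deriv θ, (haq q hq).1 θ], fun θ => ?_⟩
  have hsum : (fun θ => w q θ + (‖deriv (γ q) θ‖⁻¹ * a q θ) • deriv (γ q) θ) =
      w q + fun θ => a q θ • unitTangent (γ q) θ := by
    funext θ
    rw [Pi.add_apply, unitTangent, arcDerivLift, smul_smul, mul_comm]
  have hav : ContDiff ℝ ∞ fun θ => a q θ • unitTangent (γ q) θ :=
    (contDiff_slice ha hq).smul hI.contDiff_unitTangent
  rw [hsum, hI.sobolevOpLift_add (contDiff_slice hw hq) hav, ← hI.norm_smul_unitTangent θ,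
    real_inner_smul_right, inner_add_left, (haq q hq).2 θ, add_neg_cancel, mul_zero]

end Horizontal

/-! ### The flow of a time dependent periodic vector field -/

section Flow

/-- A time dependent vector field `b t x ∂/∂x` on the line, for `t ∈ I`, that is smooth up to the
boundary of `I` and `T`-periodic in `x`. It is the lift of a vector field on a circle. -/
structure IsPeriodicField (I : Set ℝ) (T : ℝ) (b : ℝ → ℝ → ℝ) : Prop where
  contDiffOn : ContDiffOn ℝ ∞ (fun z : ℝ × ℝ => b z.1 z.2) (I ×ˢ univ)
  periodic : ∀ t ∈ I, Function.Periodic (b t) T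

/-- `flow I b t₀ x` is the integral curve on `I` of the field `b` that passes through `x` at
time `t₀`. It is selected by choice, and is unique on `I` when `b` is a periodic field. -/
def flow (I : Set ℝ) (b : ℝ → ℝ → ℝ) (t₀ x : ℝ) : ℝ → ℝ :=
  Classical.epsilon fun u => u t₀ = x ∧ ∀ t ∈ I, HasDerivWithinAt u (b t (u t)) I t

variable {I : Set ℝ} {T : ℝ} {b : ℝ → ℝ → ℝ}

theorem IsPeriodicField.exists_lipschitzWith (hb : IsPeriodicField I T b)
    (hIu : UniqueDiffOn ℝ I) (hT : 0 < T) (a₁ a₂ : ℝ) (h : Icc a₁ a₂ ⊆ I) :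
    ∃ K : ℝ≥0, ∀ t ∈ Icc a₁ a₂, LipschitzWith K (b t) := by
  have hd := (contDiffOn_partial_deriv hIu hb.contDiffOn).continuousOn
  obtain ⟨K, hK⟩ := (isCompact_Icc.prod isCompact_Icc).exists_bound_of_continuousOn
    (hd.mono (prod_mono h (subset_univ (Icc 0 T))))
  refine ⟨K.toNNReal, fun t ht => lipschitzWith_of_nnnorm_deriv_le
    ((contDiff_slice hb.contDiffOn (h ht)).differentiable (by simp)) fun x => ?_⟩
  obtain ⟨y, hy, hxy⟩ := (hb.periodic t (h ht)).deriv.exists_mem_Ico₀ hT x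
  rw [hxy, ← NNReal.coe_le_coe, coe_nnnorm]
  exact (hK (t, y) ⟨ht, hy.1, hy.2.le⟩).trans (Real.le_coe_toNNReal K)

theorem IsPeriodicField.flow_spec (hb : IsPeriodicField I T b) (hI : I.OrdConnected)
    (hIu : UniqueDiffOn ℝ I) (hT : 0 < T) {t₀ : ℝ} (ht₀ : t₀ ∈ I) (x : ℝ) :
    flow I b t₀ x t₀ = x ∧
      ∀ t ∈ I, HasDerivWithinAt (flow I b t₀ x) (b t (flow I b t₀ x t)) I t := by
  refine Classical.epsilon_spec
    (p := fun u : ℝ → ℝ => u t₀ = x ∧ ∀ t ∈ I, HasDerivWithinAt u (b t (u t)) I t) ?_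
  refine exists_hasDerivWithinAt hI ht₀ (fun y => ?_) (hb.exists_lipschitzWith hIu hT) x
  exact hb.contDiffOn.continuousOn.comp (f := fun t : ℝ => (t, y)) (by fun_prop)
    fun t ht => ⟨ht, trivial⟩

theorem IsPeriodicField.eq_flow (hb : IsPeriodicField I T b) (hI : I.OrdConnected)
    (hIu : UniqueDiffOn ℝ I) (hT : 0 < T) {t₀ : ℝ} (ht₀ : t₀ ∈ I) {u : ℝ → ℝ}
    (hu : ∀ t ∈ I, HasDerivWithinAt u (b t (u t)) I t) {t : ℝ} (ht : t ∈ I) :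
    u t = flow I b t₀ (u t₀) t :=
  eqOn_of_hasDerivWithinAt hI ht₀ (hb.exists_lipschitzWith hIu hT) hu
    (hb.flow_spec hI hIu hT ht₀ _).2 (hb.flow_spec hI hIu hT ht₀ _).1.symm ht

/-- The flow from `t₁` back to `t₀` inverts the flow from `t₀` to `t₁`. -/
theorem IsPeriodicField.flow_flow (hb : IsPeriodicField I T b) (hI : I.OrdConnected)
    (hIu : UniqueDiffOn ℝ I) (hT : 0 < T) {t₀ t₁ : ℝ} (ht₀ : t₀ ∈ I) (ht₁ : t₁ ∈ I) (x : ℝ) :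
    flow I b t₁ (flow I b t₀ x t₁) t₀ = x := by
  rw [← hb.eq_flow hI hIu hT ht₁ (hb.flow_spec hI hIu hT ht₀ x).2 ht₀]
  exact (hb.flow_spec hI hIu hT ht₀ x).1

theorem IsPeriodicField.flow_add_period (hb : IsPeriodicField I T b) (hI : I.OrdConnected)
    (hIu : UniqueDiffOn ℝ I) (hT : 0 < T) {t₀ : ℝ} (ht₀ : t₀ ∈ I) {t : ℝ} (ht : t ∈ I) (x : ℝ) :
    flow I b t₀ (x + T) t = flow I b t₀ x t + T := by
  have h := hb.eq_flow hI hIu hT ht₀ (u := fun t => flow I b t₀ x t + T) (fun s hs => by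
    have := ((hb.flow_spec hI hIu hT ht₀ x).2 s hs).add_const T
    rwa [← hb.periodic s hs] at this) ht
  rw [h, (hb.flow_spec hI hIu hT ht₀ x).1]

/-- The flow of a smooth family of periodic fields depends smoothly on the parameter, the initial
point and time. -/
theorem contDiffOn_flow {E : Type} [NormedAddCommGroup E] [NormedSpace ℝ E]
    [FiniteDimensional ℝ E] (hI : I.OrdConnected) (hIu : UniqueDiffOn ℝ I) (hT : 0 < T)
    {b : E → ℝ → ℝ → ℝ}
    (hbs : ContDiffOn ℝ ∞ (fun z : (E × ℝ) × ℝ => b z.1.1 z.1.2 z.2) ((univ ×ˢ I) ×ˢ univ))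
    (hb : ∀ p, IsPeriodicField I T (b p)) {t₀ : ℝ} (ht₀ : t₀ ∈ I) :
    ContDiffOn ℝ ∞ (fun z : (E × ℝ) × ℝ => flow I (b z.1.1) t₀ z.1.2 z.2) (univ ×ˢ I) := by
  have hspec := fun p => (hb p).flow_spec hI hIu hT ht₀
  refine contDiffOn_solution (t₀ := t₀)
    (f := fun z : (E × ℝ) × ℝ × ℝ => b z.1.1 z.2.1 z.2.2) convex_univ uniqueDiffOn_univ hI hIu ht₀
    ?_ (fun q _ => (hspec q.1 q.2).2) ?_ (fun q₀ _ a₁ a₂ hab h0 => ?_)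
  · exact hbs.comp (f := fun z : (E × ℝ) × ℝ × ℝ => ((z.1.1, z.2.1), z.2.2)) (by fun_prop)
      fun z hz => ⟨⟨trivial, hz.2.1⟩, trivial⟩
  · exact contDiffOn_snd.congr fun q _ => (hspec q.1 q.2).1
  · -- the field is bounded near `q₀`, uniformly on the line because it is periodic
    have hc : ContinuousOn (fun z : (E × ℝ) × ℝ × ℝ => b z.1.1 z.2.1 z.2.2)
        (univ ×ˢ I ×ˢ univ) :=
      hbs.continuousOn.comp (f := fun z : (E × ℝ) × ℝ × ℝ => ((z.1.1, z.2.1), z.2.2))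
        (by fun_prop) fun z hz => ⟨⟨trivial, hz.2.1⟩, trivial⟩
    obtain ⟨M, hM0, δ, hδ, hM⟩ := exists_forall_norm_le_near hc (mem_univ q₀) hab T
    refine exists_eventually_norm_solution_le (S := univ) (J := I)
      (f := fun z : (E × ℝ) × ℝ × ℝ => b z.1.1 z.2.1 z.2.2)
      (u := fun z : (E × ℝ) × ℝ => flow I (b z.1.1) t₀ z.1.2 z.2) (mem_univ q₀) hab h0
      (fun q _ => (hspec q.1 q.2).2)
      (continuousOn_snd.congr fun q _ => (hspec q.1 q.2).1) hM0 ?_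
    filter_upwards [mem_nhdsWithin_of_mem_nhds (Metric.ball_mem_nhds q₀ hδ)] with q hq t ht x
    obtain ⟨y, hy, hxy⟩ := ((hb q.1).periodic t (hab ht)).exists_mem_Ico₀ hT x
    rw [hxy]
    refine (hM q ⟨trivial, hq⟩ t ht y ?_).trans (by linarith [mul_nonneg hM0 (norm_nonneg x)])
    rw [mem_closedBall_zero_iff, Real.norm_eq_abs, abs_of_nonneg hy.1]
    exact hy.2.le

theorem IsPeriodicField.contDiffOn_flow (hb : IsPeriodicField I T b) (hI : I.OrdConnected)
    (hIu : UniqueDiffOn ℝ I) (hT : 0 < T) {t₀ : ℝ} (ht₀ : t₀ ∈ I) :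
    ContDiffOn ℝ ∞ (fun z : ℝ × ℝ => flow I b t₀ z.1 z.2) (univ ×ˢ I) := by
  have h := ShapeSpace.contDiffOn_flow (E := ℝ) (b := fun _ => b) hI hIu hT
    (hb.contDiffOn.comp (f := fun z : (ℝ × ℝ) × ℝ => (z.1.2, z.2)) (by fun_prop)
      fun z hz => ⟨hz.1.2, trivial⟩) (fun _ => hb) ht₀
  exact h.comp (f := fun z : ℝ × ℝ => (((0 : ℝ), z.1), z.2)) (by fun_prop)
    fun z hz => ⟨trivial, hz.2⟩

theorem IsPeriodicField.contDiff_flow (hb : IsPeriodicField I T b) (hI : I.OrdConnected)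
    (hIu : UniqueDiffOn ℝ I) (hT : 0 < T) {t₀ : ℝ} (ht₀ : t₀ ∈ I) {t : ℝ} (ht : t ∈ I) :
    ContDiff ℝ ∞ fun x => flow I b t₀ x t := by
  rw [← contDiffOn_univ]
  exact (hb.contDiffOn_flow hI hIu hT ht₀).comp (f := fun x : ℝ => (x, t)) (by fun_prop)
    fun x _ => ⟨trivial, ht⟩

/-- The flow maps are orientation preserving: they are injective and commute with the translation
by the period, hence strictly increasing, and they have a differentiable inverse. -/
theorem IsPeriodicField.deriv_flow_pos (hb : IsPeriodicField I T b) (hI : I.OrdConnected)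
    (hIu : UniqueDiffOn ℝ I) (hT : 0 < T) {t₀ : ℝ} (ht₀ : t₀ ∈ I) {t : ℝ} (ht : t ∈ I) (x : ℝ) :
    0 < deriv (fun x => flow I b t₀ x t) x := by
  have hinv : Function.LeftInverse (fun x => flow I b t x t₀) (fun x => flow I b t₀ x t) :=
    hb.flow_flow hI hIu hT ht₀ ht
  have hs := hb.contDiff_flow hI hIu hT ht₀ ht
  have hs' := hb.contDiff_flow hI hIu hT ht ht₀
  have hmono : StrictMono fun x => flow I b t₀ x t := by
    refine (hs.continuous.strictMono_of_inj hinv.injective).resolve_right fun hanti => ?_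
    have h1 := hanti (lt_add_of_pos_right 0 hT)
    simp only at h1
    rw [hb.flow_add_period hI hIu hT ht₀ ht] at h1
    linarith
  refine lt_of_le_of_ne hmono.monotone.deriv_nonneg fun h0 => ?_
  have h2 := ((hs'.differentiable (by simp) (flow I b t₀ x t)).hasDerivAt.comp x
    (hs.differentiable (by simp) x).hasDerivAt).deriv
  rw [hinv.comp_eq_id, deriv_id, ← h0, mul_zero] at h2
  exact one_ne_zero h2

end Flow

/-! ### Maps on the circle and their periodic lifts -/

section Circle

/-- The covering `exp : ℝ → S¹` has sections that are smooth near a given point. -/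
theorem exists_smooth_section_circleExp (z₀ : Circle) :
    ∃ σ : Circle → ℝ, ContMDiffAt (𝓡 1) 𝓘(ℝ, ℝ) ∞ σ z₀ ∧ ∀ z, Circle.exp (σ z) = z := by
  obtain ⟨θ₀, hθ₀⟩ := Circle.exp_surjective z₀
  refine ⟨fun z => θ₀ + Complex.arg ((z * z₀⁻¹ : Circle) : ℂ), ?_, fun z => ?_⟩
  · have h1 : ContMDiff (𝓡 1) 𝓘(ℝ, ℂ) ∞ (fun z : Circle => ((z * z₀⁻¹ : Circle) : ℂ)) :=
      haveI : Fact (Module.finrank ℝ ℂ = 1 + 1) := finrank_real_complex_fact'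
      (contMDiff_coe_sphere (E := ℂ) (n := 1)).comp (contMDiff_mul_right (a := z₀⁻¹))
    have h2 : ContDiffAt ℝ ∞ (fun w : ℂ => θ₀ + Complex.arg w) ((z₀ * z₀⁻¹ : Circle) : ℂ) := by
      rw [mul_inv_cancel]
      have h3 : ContDiffAt ℝ ∞ Complex.log ((1 : Circle) : ℂ) :=
        (Complex.contDiffAt_log (n := ∞) (by simp)).restrict_scalars ℝ
      have h4 := Complex.imCLM.contDiff.contDiffAt.comp _ h3
      have h5 : (⇑Complex.imCLM ∘ Complex.log) = Complex.arg := by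
        funext w; simp [Complex.log_im]
      rw [h5] at h4
      exact contDiffAt_const.add h4
    exact ContMDiffAt.comp (g := fun w : ℂ => θ₀ + Complex.arg w)
      (f := fun z : Circle => ((z * z₀⁻¹ : Circle) : ℂ)) z₀ h2.contMDiffAt (h1 z₀)
  · rw [Circle.exp_add, hθ₀, Circle.exp_arg]
    simp

variable {E : Type*} [NormedAddCommGroup E] [NormedSpace ℝ E] {S : Set E}

/-- A family of maps on the circle is smooth if its lift to the line is smooth. -/
theorem contMDiffOn_of_lift {F : Type*} [NormedAddCommGroup F] [NormedSpace ℝ F] {H : Type*}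
    [TopologicalSpace H] {J : ModelWithCorners ℝ F H} {M : Type*} [TopologicalSpace M]
    [ChartedSpace H M] {G : E × Circle → M} {g : E × ℝ → M}
    (hg : ContMDiffOn 𝓘(ℝ, E × ℝ) J ∞ g (S ×ˢ univ))
    (hG : ∀ s ∈ S, ∀ θ, G (s, Circle.exp θ) = g (s, θ)) :
    ContMDiffOn (𝓘(ℝ, E).prod (𝓡 1)) J ∞ G (S ×ˢ univ) := by
  rintro ⟨s₀, z₀⟩ hs₀
  obtain ⟨σ, hσ, hσ'⟩ := exists_smooth_section_circleExp z₀
  have h1 : ContMDiffWithinAt (𝓘(ℝ, E).prod (𝓡 1)) 𝓘(ℝ, E × ℝ) ∞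
      (fun y : E × Circle => (y.1, σ y.2)) (S ×ˢ univ) (s₀, z₀) :=
    (contMDiffAt_fst.prodMk_space (hσ.comp (s₀, z₀) contMDiffAt_snd)).contMDiffWithinAt
  have hmaps : MapsTo (fun y : E × Circle => (y.1, σ y.2)) (S ×ˢ univ) (S ×ˢ univ) :=
    fun y hy => ⟨hy.1, trivial⟩
  have h2 := (hg (s₀, σ z₀) ⟨hs₀.1, trivial⟩).comp (s₀, z₀) h1 hmaps
  exact h2.congr (fun y hy => by simp [← hG y.1 hy.1, hσ']) (by simp [← hG s₀ hs₀.1, hσ'])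

theorem contDiffOn_lift {F : Type*} [NormedAddCommGroup F] [NormedSpace ℝ F] {G : E × Circle → F}
    (hG : ContMDiffOn (𝓘(ℝ, E).prod (𝓡 1)) 𝓘(ℝ, F) ∞ G (S ×ˢ univ)) :
    ContDiffOn ℝ ∞ (fun y : E × ℝ => G (y.1, Circle.exp y.2)) (S ×ˢ univ) := by
  rw [← contMDiffOn_iff_contDiffOn]
  have h1 : ContMDiff 𝓘(ℝ, E × ℝ) (𝓘(ℝ, E).prod (𝓡 1)) ∞
      (fun y : E × ℝ => (y.1, Circle.exp y.2)) :=
    contDiff_fst.contMDiff.prodMk (contMDiff_circleExp.comp contDiff_snd.contMDiff)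
  exact hG.comp h1.contMDiffOn fun y hy => ⟨hy.1, trivial⟩

theorem dTheta_circleExp {V : Type*} [NormedAddCommGroup V] [NormedSpace ℝ V] (f : Circle → V)
    (θ : ℝ) : dTheta f (Circle.exp θ) = deriv (fun x => f (Circle.exp x)) θ := by
  simp only [dTheta, ← Circle.exp_add]
  rw [deriv_comp_const_add (fun x => f (Circle.exp x)) θ 0, add_zero]

theorem iterate_arcDeriv_circleExp (c f : Circle → Plane) (m : ℕ) :
    (fun x => ((arcDeriv c)^[m] f) (Circle.exp x)) =
      (arcDerivLift fun x => c (Circle.exp x))^[m] fun x => f (Circle.exp x) := by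
  induction m with
  | zero => rfl
  | succ m ih =>
    rw [Function.iterate_succ_apply', Function.iterate_succ_apply', ← ih]
    funext θ
    rw [arcDeriv, dTheta_circleExp, dTheta_circleExp, arcDerivLift]

theorem sobolevOp_circleExp (A : ℝ) (n : ℕ) (c h : Circle → Plane) (θ : ℝ) :
    sobolevOp A n c h (Circle.exp θ) =
      sobolevOpLift A n (fun x => c (Circle.exp x)) (fun x => h (Circle.exp x)) θ := by
  rw [sobolevOp, sobolevOpLift, ← iterate_arcDeriv_circleExp]

/-- The map of the circle with lift `φ`. -/
def circleMap (φ : ℝ → ℝ) (z : Circle) : Circle := Circle.exp (φ (Complex.arg z))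

theorem circleMap_circleExp {φ : ℝ → ℝ} (hφ : ∀ x, φ (x + 2 * π) = φ x + 2 * π) (x : ℝ) :
    circleMap φ (Circle.exp x) = Circle.exp (φ x) := by
  have hper : Function.Periodic (fun x => Circle.exp (φ x)) (2 * π) := fun x => by
    simp only [hφ, Circle.periodic_exp (φ x)]
  obtain ⟨m, hm⟩ := Circle.exp_eq_exp.1 (Circle.exp_arg (Circle.exp x))
  rw [circleMap, hm]
  exact hper.int_mul m x

/-- Reparametrization invariance of the arc length derivative. -/
theorem iterate_arcDerivLift_comp {γ f : ℝ → Plane} {φ : ℝ → ℝ} {T : ℝ}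
    (hγ : IsPeriodicImmersion T γ) (hf : ContDiff ℝ ∞ f) (hφ : Differentiable ℝ φ)
    (hφ' : ∀ x, 0 < deriv φ x) (m : ℕ) :
    (arcDerivLift fun x => γ (φ x))^[m] (fun x => f (φ x)) =
      fun x => ((arcDerivLift γ)^[m] f) (φ x) := by
  have hcomp : ∀ {g : ℝ → Plane}, ContDiff ℝ ∞ g → ∀ x,
      deriv (fun x => g (φ x)) x = deriv φ x • deriv g (φ x) := fun hg x =>
    ((hg.differentiable (by simp) (φ x)).hasDerivAt.scomp x (hφ x).hasDerivAt).deriv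
  induction m with
  | zero => rfl
  | succ m ih =>
    rw [Function.iterate_succ_apply', Function.iterate_succ_apply', ih]
    funext x
    rw [arcDerivLift, arcDerivLift, hcomp hγ.contDiff, hcomp (hγ.contDiff_iterate hf m), norm_smul,
      Real.norm_of_nonneg (hφ' x).le, mul_inv, smul_smul, mul_right_comm,
      inv_mul_cancel₀ (hφ' x).ne', one_mul]

end Circle

/-! ### Horizontal reparametrization of paths of immersions -/

section Paths

variable {I : Set ℝ}

/-- The lift `(t, θ) ↦ c t (exp (i θ))` of a path of immersions; it is extended by zero to times
outside of `I`. -/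
def ImmPath.lift (c : ImmPath I) (t θ : ℝ) : Plane :=
  open scoped Classical in if h : t ∈ I then c ⟨t, h⟩ (Circle.exp θ) else 0

/-- The velocity `c_t` of a path of immersions, lifted to the line. -/
def ImmPath.velocity (c : ImmPath I) (t θ : ℝ) : Plane := derivWithin (fun s => c.lift s θ) I t

/-- The vector field on the circle whose flow makes the path `c` horizontal. For `t ∈ I` a
horizontal lift exists and is unique, so that the choice made here is immaterial. -/
def ImmPath.field (A : ℝ) (n : ℕ) (c : ImmPath I) (t : ℝ) : ℝ → ℝ :=
  Classical.epsilon (IsHorizontalLift A n (2 * π) (c.lift t) (c.velocity t))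

theorem ImmPath.lift_of_mem (c : ImmPath I) {t : ℝ} (ht : t ∈ I) (θ : ℝ) :
    c.lift t θ = c ⟨t, ht⟩ (Circle.exp θ) := dif_pos ht

theorem ImmPath.lift_periodic (c : ImmPath I) (t : ℝ) : Function.Periodic (c.lift t) (2 * π) :=
  fun θ => by simp only [ImmPath.lift, Circle.periodic_exp θ]

theorem ImmPath.velocity_periodic (c : ImmPath I) (t : ℝ) :
    Function.Periodic (c.velocity t) (2 * π) :=
  fun θ => by simp only [ImmPath.velocity, fun s => c.lift_periodic s θ]

/-- A family of paths of immersions whose lifts depend smoothly on parameter, time and angle. -/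
def IsSmoothLiftFamily {E : Type*} [NormedAddCommGroup E] [NormedSpace ℝ E]
    (c : E → ImmPath I) : Prop :=
  ContDiffOn ℝ ∞ (fun z : (E × ℝ) × ℝ => (c z.1.1).lift z.1.2 z.2) ((univ ×ˢ I) ×ˢ univ)

theorem isSmoothLiftFamily_of_smoothInParam {E : Type*} [NormedAddCommGroup E] [NormedSpace ℝ E]
    {c : E → ImmPath I} (hc : SmoothInParam 𝓘(ℝ, Plane) (fun p t z => c p t z)) :
    IsSmoothLiftFamily c := by
  obtain ⟨G, hG, hGc⟩ := hc
  refine (contDiffOn_lift hG).congr fun z hz => ?_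
  rw [ImmPath.lift_of_mem _ hz.1.2]
  exact (hGc ⟨z.1, hz.1⟩ _).symm

theorem isSmoothLiftFamily_const {E : Type*} [NormedAddCommGroup E] [NormedSpace ℝ E]
    (c : ImmPath I) : IsSmoothLiftFamily fun _ : E => c := by
  obtain ⟨G, hG, hGc⟩ := c.smooth
  have h := (contDiffOn_lift hG).comp (f := fun z : (E × ℝ) × ℝ => (z.1.2, z.2))
    (s := (univ ×ˢ I) ×ˢ univ) (by fun_prop) fun z hz => ⟨hz.1.2, trivial⟩
  refine h.congr fun z hz => ?_
  rw [ImmPath.lift_of_mem _ hz.1.2]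
  exact (hGc ⟨z.1.2, hz.1.2⟩ _).symm

theorem ImmPath.contDiffOn_lift (c : ImmPath I) :
    ContDiffOn ℝ ∞ (fun z : ℝ × ℝ => c.lift z.1 z.2) (I ×ˢ univ) :=
  (isSmoothLiftFamily_const (E := ℝ) c).comp (f := fun z : ℝ × ℝ => (((0 : ℝ), z.1), z.2))
    (by fun_prop) fun z hz => ⟨⟨trivial, hz.1⟩, trivial⟩

theorem ImmPath.isPeriodicImmersion (c : ImmPath I) {t : ℝ} (ht : t ∈ I) :
    IsPeriodicImmersion (2 * π) (c.lift t) where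
  contDiff := contDiff_slice c.contDiffOn_lift ht
  periodic := c.lift_periodic t
  deriv_ne_zero θ := by
    have h := (c ⟨t, ht⟩).dTheta_ne_zero (Circle.exp θ)
    rw [dTheta_circleExp] at h
    rwa [show c.lift t = fun x => c ⟨t, ht⟩ (Circle.exp x) from funext (c.lift_of_mem ht)]

theorem IsSmoothLiftFamily.velocity {E : Type*} [NormedAddCommGroup E] [NormedSpace ℝ E]
    {c : E → ImmPath I} (hc : IsSmoothLiftFamily c) (hIu : UniqueDiffOn ℝ I) :
    ContDiffOn ℝ ∞ (fun z : (E × ℝ) × ℝ => (c z.1.1).velocity z.1.2 z.2)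
      ((univ ×ˢ I) ×ˢ univ) := by
  have h1 : ContDiffOn ℝ ∞ (fun z : (E × ℝ) × ℝ => (c z.1.1).lift z.2 z.1.2) (univ ×ˢ I) :=
    hc.comp (f := fun z : (E × ℝ) × ℝ => ((z.1.1, z.2), z.1.2)) (by fun_prop)
      fun z hz => ⟨⟨trivial, hz.2⟩, trivial⟩
  have h2 := contDiffOn_partial_derivWithin (f := fun (q : E × ℝ) s => (c q.1).lift s q.2)
    uniqueDiffOn_univ hIu h1
  exact h2.comp (f := fun z : (E × ℝ) × ℝ => ((z.1.1, z.2), z.1.2)) (by fun_prop)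
      fun z hz => ⟨trivial, hz.1.2⟩

/-- The field of a smooth family of paths is smooth: by uniqueness of horizontal lifts it coincides
with a solution of the elliptic equation that depends smoothly on parameter and time. -/
theorem IsSmoothLiftFamily.contDiffOn_field {E : Type} [NormedAddCommGroup E] [NormedSpace ℝ E]
    [FiniteDimensional ℝ E] {c : E → ImmPath I} (hc : IsSmoothLiftFamily c)
    (hI : I.OrdConnected) (hIu : UniqueDiffOn ℝ I) {A : ℝ} (hA : 0 < A) (n : ℕ) :
    ContDiffOn ℝ ∞ (fun z : (E × ℝ) × ℝ => (c z.1.1).field A n z.1.2 z.2) ((univ ×ˢ I) ×ˢ univ) ∧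
      ∀ p, ∀ t ∈ I, IsHorizontalLift A n (2 * π) ((c p).lift t) ((c p).velocity t)
        ((c p).field A n t) := by
  have hfam : IsImmersionFamily (univ ×ˢ I) (2 * π) fun q : E × ℝ => (c q.1).lift q.2 :=
    ⟨hc, fun q hq => (c q.1).isPeriodicImmersion hq.2⟩
  have hw := hc.velocity hIu
  obtain ⟨α, hα, hαq⟩ := hfam.exists_horizontalLift Real.two_pi_pos
    (convex_univ.prod hI.convex) (uniqueDiffOn_univ.prod hIu) hA n
    (w := fun q : E × ℝ => (c q.1).velocity q.2) hw (fun q _ => (c q.1).velocity_periodic q.2)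
  have hfield : ∀ p, ∀ t ∈ I, IsHorizontalLift A n (2 * π) ((c p).lift t) ((c p).velocity t)
      ((c p).field A n t) := fun p t ht =>
    Classical.epsilon_spec (p := IsHorizontalLift A n (2 * π) ((c p).lift t) ((c p).velocity t))
      ⟨_, hαq (p, t) ⟨trivial, ht⟩⟩
  refine ⟨hα.congr fun z hz => ?_, hfield⟩
  exact congrFun ((hfield z.1.1 z.1.2 hz.1.2).unique hA Real.two_pi_pos
    ((c z.1.1).isPeriodicImmersion hz.1.2)
    (contDiff_slice (f := fun q : E × ℝ => (c q.1).velocity q.2) hw hz.1) (hαq z.1 hz.1)) z.2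

variable {A : ℝ}

theorem ImmPath.isHorizontalLift_field (c : ImmPath I) (hI : I.OrdConnected)
    (hIu : UniqueDiffOn ℝ I) (hA : 0 < A) (n : ℕ) {t : ℝ} (ht : t ∈ I) :
    IsHorizontalLift A n (2 * π) (c.lift t) (c.velocity t) (c.field A n t) :=
  ((isSmoothLiftFamily_const (E := ℝ) c).contDiffOn_field hI hIu hA n).2 0 t ht

theorem ImmPath.isPeriodicField (c : ImmPath I) (hI : I.OrdConnected)
    (hIu : UniqueDiffOn ℝ I) (hA : 0 < A) (n : ℕ) :
    IsPeriodicField I (2 * π) (c.field A n) where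
  contDiffOn := ((isSmoothLiftFamily_const (E := ℝ) c).contDiffOn_field hI hIu hA n).1.comp
    (f := fun z : ℝ × ℝ => (((0 : ℝ), z.1), z.2)) (by fun_prop)
    fun z hz => ⟨⟨trivial, hz.1⟩, trivial⟩
  periodic _ ht := (c.isHorizontalLift_field hI hIu hA n ht).periodic

/-- The flow maps of a periodic field on the line, as diffeomorphisms of the circle. -/
def IsPeriodicField.flowDiffeo {b : ℝ → ℝ → ℝ} (hb : IsPeriodicField I (2 * π) b)
    (hI : I.OrdConnected) (hIu : UniqueDiffOn ℝ I) {t₀ t : ℝ} (ht₀ : t₀ ∈ I) (ht : t ∈ I) :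
    DiffCircle :=
  have hsmooth : ∀ {t₀ t : ℝ}, t₀ ∈ I → t ∈ I →
      ContMDiff (𝓡 1) (𝓡 1) ∞ (circleMap fun x => flow I b t₀ x t) := fun ht₀ ht => by
    intro z
    obtain ⟨σ, hσ, hσ'⟩ := exists_smooth_section_circleExp z
    have h1 : ContMDiffAt (𝓡 1) (𝓡 1) ∞ (fun z => Circle.exp (flow I b _ (σ z) _)) z :=
      ((contMDiff_circleExp.comp
        (hb.contDiff_flow hI hIu Real.two_pi_pos ht₀ ht).contMDiff).contMDiffAt).comp z hσ
    refine h1.congr_of_eventuallyEq (Eventually.of_forall fun z => ?_)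
    conv_lhs => rw [← hσ' z]
    exact circleMap_circleExp (hb.flow_add_period hI hIu Real.two_pi_pos ht₀ ht) _
  have hinv : ∀ {t₀ t : ℝ}, t₀ ∈ I → t ∈ I → Function.LeftInverse
      (circleMap fun x => flow I b t x t₀) (circleMap fun x => flow I b t₀ x t) :=
    fun ht₀ ht z => by
      obtain ⟨x, rfl⟩ := Circle.exp_surjective z
      rw [circleMap_circleExp (hb.flow_add_period hI hIu Real.two_pi_pos ht₀ ht),
        circleMap_circleExp (hb.flow_add_period hI hIu Real.two_pi_pos ht ht₀),
        hb.flow_flow hI hIu Real.two_pi_pos ht₀ ht]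
  { toFun := circleMap fun x => flow I b t₀ x t
    invFun := circleMap fun x => flow I b t x t₀
    left_inv := hinv ht₀ ht
    right_inv := hinv ht ht₀
    contMDiff_toFun := hsmooth ht₀ ht
    contMDiff_invFun := hsmooth ht ht₀ }

theorem IsPeriodicField.flowDiffeo_circleExp {b : ℝ → ℝ → ℝ} (hb : IsPeriodicField I (2 * π) b)
    (hI : I.OrdConnected) (hIu : UniqueDiffOn ℝ I) {t₀ t : ℝ} (ht₀ : t₀ ∈ I) (ht : t ∈ I) (x : ℝ) :
    hb.flowDiffeo hI hIu ht₀ ht (Circle.exp x) = Circle.exp (flow I b t₀ x t) :=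
  circleMap_circleExp (φ := fun x => flow I b t₀ x t)
    (hb.flow_add_period hI hIu Real.two_pi_pos ht₀ ht) x

/-- The flow of a smooth family of fields is a smooth family of maps of the circle. -/
theorem smoothInParam_of_flow {E : Type} [NormedAddCommGroup E] [NormedSpace ℝ E]
    [FiniteDimensional ℝ E] (hI : I.OrdConnected) (hIu : UniqueDiffOn ℝ I)
    {b : E → ℝ → ℝ → ℝ}
    (hbs : ContDiffOn ℝ ∞ (fun z : (E × ℝ) × ℝ => b z.1.1 z.1.2 z.2) ((univ ×ˢ I) ×ˢ univ))
    (hb : ∀ p, IsPeriodicField I (2 * π) (b p)) {t₀ : ℝ} (ht₀ : t₀ ∈ I)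
    {g : E → I → Circle → Circle}
    (hg : ∀ p (t : I) x, g p t (Circle.exp x) = Circle.exp (flow I (b p) t₀ x t)) :
    SmoothInParam (𝓡 1) g := by
  have h1 := contDiffOn_flow hI hIu Real.two_pi_pos hbs hb ht₀
  have h2 : ContDiffOn ℝ ∞ (fun z : (E × ℝ) × ℝ => flow I (b z.1.1) t₀ z.2 z.1.2)
      ((univ ×ˢ I) ×ˢ univ) :=
    h1.comp (f := fun z : (E × ℝ) × ℝ => ((z.1.1, z.2), z.1.2)) (by fun_prop)
      fun z hz => ⟨trivial, hz.1.2⟩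
  have h3 : ContMDiffOn 𝓘(ℝ, (E × ℝ) × ℝ) (𝓡 1) ∞
      (fun z : (E × ℝ) × ℝ => Circle.exp (flow I (b z.1.1) t₀ z.2 z.1.2))
      ((univ ×ˢ I) ×ˢ univ) := contMDiff_circleExp.comp_contMDiffOn h2.contMDiffOn
  refine ⟨fun y => circleMap (fun x => flow I (b y.1.1) t₀ x y.1.2) y.2,
    contMDiffOn_of_lift h3 fun q hq θ =>
      circleMap_circleExp ((hb q.1).flow_add_period hI hIu Real.two_pi_pos ht₀ hq.2) θ,
    fun q z => ?_⟩
  obtain ⟨x, rfl⟩ := Circle.exp_surjective z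
  exact (circleMap_circleExp (φ := fun x => flow I (b q.1.1) t₀ x q.1.2)
    ((hb _).flow_add_period hI hIu Real.two_pi_pos ht₀ q.2.2) x).trans
    (hg q.1.1 ⟨q.1.2, q.2.2⟩ x).symm

/-- The path of reparametrizations that makes `c` horizontal. -/
def horizontalReparam (hI : I.OrdConnected) (hIu : UniqueDiffOn ℝ I) (h0 : (0 : ℝ) ∈ I)
    (hA : 0 < A) (n : ℕ) (c : ImmPath I) : DiffPath I where
  toFun t := (c.isPeriodicField hI hIu hA n).flowDiffeo hI hIu h0 t.2
  smooth := by
    obtain ⟨G, hG, hGc⟩ := smoothInParam_of_flow (E := ℝ) hI hIu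
      ((isSmoothLiftFamily_const (E := ℝ) c).contDiffOn_field hI hIu hA n).1
      (fun _ => c.isPeriodicField hI hIu hA n) h0
      (g := fun _ t z => (c.isPeriodicField hI hIu hA n).flowDiffeo hI hIu h0 t.2 z)
      (fun _ t x => (c.isPeriodicField hI hIu hA n).flowDiffeo_circleExp hI hIu h0 t.2 x)
    refine ⟨fun y => G (((0 : ℝ), y.1), y.2), ?_, fun t z =>
      hGc ⟨((0 : ℝ), (t : ℝ)), ⟨trivial, t.2⟩⟩ z⟩
    have h1 : ContMDiff (𝓘(ℝ, ℝ).prod (𝓡 1)) (𝓘(ℝ, ℝ × ℝ).prod (𝓡 1)) ∞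
        (fun y : ℝ × Circle => (((0 : ℝ), y.1), y.2)) :=
      ((contMDiff_const.prodMk_space contMDiff_fst).prodMk contMDiff_snd)
    exact hG.comp h1.contMDiffOn fun y hy => ⟨⟨trivial, hy.1⟩, trivial⟩

theorem horizontalReparam_circleExp (hI : I.OrdConnected) (hIu : UniqueDiffOn ℝ I)
    (h0 : (0 : ℝ) ∈ I) (hA : 0 < A) (n : ℕ) (c : ImmPath I) (t : I) (x : ℝ) :
    horizontalReparam hI hIu h0 hA n c t (Circle.exp x) =
      Circle.exp (flow I (c.field A n) 0 x t) :=
  (c.isPeriodicField hI hIu hA n).flowDiffeo_circleExp hI hIu h0 t.2 x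

/-- The chain rule for the reparametrized path: `∂ₜ (c (t, φ t)) = c_t + φ' c_θ`. -/
theorem ImmPath.hasDerivWithinAt_lift_comp (c : ImmPath I) (hIu : UniqueDiffOn ℝ I) {t : ℝ}
    (ht : t ∈ I) {φ : ℝ → ℝ} {φ' : ℝ} (hφ : HasDerivWithinAt φ φ' I t) :
    HasDerivWithinAt (fun s => c.lift s (φ s)) (c.velocity t (φ t) + φ' • deriv (c.lift t) (φ t))
      I t := by
  have hF := (c.contDiffOn_lift.differentiableOn (by simp) (t, φ t)
    ⟨ht, trivial⟩).hasFDerivWithinAt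
  set D := fderivWithin ℝ (fun z : ℝ × ℝ => c.lift z.1 z.2) (I ×ˢ univ) (t, φ t)
  have hD : ∀ {ψ : ℝ → ℝ} {ψ' : ℝ}, ψ t = φ t → HasDerivWithinAt ψ ψ' I t →
      HasDerivWithinAt (fun s => c.lift s (ψ s)) (D (1, ψ')) I t := fun {ψ ψ'} h0 hψ => by
    rw [← h0] at hF
    have hmaps : MapsTo (fun s : ℝ => (s, ψ s)) I (I ×ˢ univ) := fun s hs => ⟨hs, trivial⟩
    exact hF.comp_hasDerivWithinAt t ((hasDerivWithinAt_id t I).prodMk hψ) hmaps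
  have h1 : c.velocity t (φ t) = D (1, 0) :=
    (hD (ψ := fun _ => φ t) rfl (hasDerivWithinAt_const t I (φ t))).derivWithin (hIu t ht)
  have h2 : deriv (c.lift t) (φ t) = D (0, 1) := by
    have hmaps : MapsTo (fun x : ℝ => (t, x)) univ (I ×ˢ univ) := fun s _ => ⟨ht, trivial⟩
    have h3 := hF.comp_hasDerivWithinAt (φ t)
      ((hasDerivWithinAt_const (φ t) univ t).prodMk (hasDerivWithinAt_id (φ t) univ)) hmaps
    exact (hasDerivWithinAt_univ.1 h3).deriv
  have h4 : D (1, φ') = D (1, 0) + φ' • D (0, 1) := by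
    rw [← map_smul, ← map_add]; simp
  rw [h1, h2, ← h4]
  exact hD rfl hφ

/-- With `φ` the flow of the field `α`, the reparametrized path `e = c ∘ φ` has
`e_t = (c_t + α c_θ) ∘ φ`; as `L` commutes with reparametrizations, `L e_t` is orthogonal to
`e_θ`. -/
theorem isHorizontal_horizontalReparam (hI : I.OrdConnected) (hIu : UniqueDiffOn ℝ I)
    (h0 : (0 : ℝ) ∈ I) (hA : 0 < A) (n : ℕ) (c : ImmPath I) :
    IsHorizontal A n (fun t z => c t (horizontalReparam hI hIu h0 hA n c t z)) := by
  intro t z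
  obtain ⟨x, rfl⟩ := Circle.exp_surjective z
  have hb := c.isPeriodicField hI hIu hA n
  have hspec := fun y => hb.flow_spec hI hIu Real.two_pi_pos h0 y
  have hγ := c.isPeriodicImmersion t.2
  have hα := c.isHorizontalLift_field hI hIu hA n t.2
  have hφ : Differentiable ℝ fun y => flow I (c.field A n) 0 y t :=
    (hb.contDiff_flow hI hIu Real.two_pi_pos h0 t.2).differentiable (by simp)
  have hφ' := hb.deriv_flow_pos hI hIu Real.two_pi_pos h0 t.2
  have hk : ContDiff ℝ ∞
      fun θ => c.velocity t θ + c.field A n t θ • deriv (c.lift t) θ := by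
    have hw := contDiff_slice (f := fun q : ℝ × ℝ => c.velocity q.2)
      ((isSmoothLiftFamily_const (E := ℝ) c).velocity hIu) (q := (0, (t : ℝ))) ⟨trivial, t.2⟩
    exact hw.add (hα.contDiff.smul (contDiff_deriv hγ.contDiff))
  -- the lifts of `e` and of `e_t`
  have he : ∀ (s : I) y, c s (horizontalReparam hI hIu h0 hA n c s (Circle.exp y)) =
      c.lift s (flow I (c.field A n) 0 y s) := fun s y => by
    rw [horizontalReparam_circleExp, c.lift_of_mem s.2]
  have het : ∀ y, timeDeriv (fun t z => c t (horizontalReparam hI hIu h0 hA n c t z)) t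
      (Circle.exp y) = (fun θ => c.velocity t θ + c.field A n t θ • deriv (c.lift t) θ)
        (flow I (c.field A n) 0 y t) := fun y => by
    have hext : ∀ s ∈ I, Function.extend Subtype.val (fun s : I => c s
        (horizontalReparam hI hIu h0 hA n c s (Circle.exp y))) 0 s =
          c.lift s (flow I (c.field A n) 0 y s) := fun s hs => by
      rw [← he ⟨s, hs⟩ y]
      exact Subtype.val_injective.extend_apply _ _ (⟨s, hs⟩ : I)
    rw [timeDeriv, derivWithin_congr hext (hext t t.2)]
    exact (c.hasDerivWithinAt_lift_comp hIu t.2 ((hspec y).2 t t.2)).derivWithin (hIu t t.2)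
  rw [sobolevOp_circleExp, dTheta_circleExp]
  simp only [he, het]
  rw [sobolevOpLift, iterate_arcDerivLift_comp hγ hk hφ hφ']
  have hd : deriv (fun y => c.lift t (flow I (c.field A n) 0 y t)) x =
      deriv (fun y => flow I (c.field A n) 0 y t) x •
        deriv (c.lift t) (flow I (c.field A n) 0 x t) :=
    ((hγ.contDiff.differentiable (by simp) _).hasDerivAt.scomp x (hφ x).hasDerivAt).deriv
  rw [hd, real_inner_smul_right]
  exact mul_eq_zero_of_right _ (hα.inner_eq_zero _)

end Paths

end ShapeSpace

end

theorem mainTheorem4 (A : ℝ) (hA : 0 < A) (n : ℕ)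
    (I : Set ℝ) (hI : I.OrdConnected) (hI' : I.Nontrivial) (h0 : (0 : ℝ) ∈ I) :
    ∃ Φ : ShapeSpace.ImmPath I → ShapeSpace.DiffPath I,
      ShapeSpace.IsSmoothMap Φ ∧
      ∀ c : ShapeSpace.ImmPath I,
        (∀ z : Circle, Φ c ⟨0, h0⟩ z = z) ∧
        ShapeSpace.IsHorizontal A n (fun t z => c t (Φ c t z)) := by
  have hIu : UniqueDiffOn ℝ I := by
    obtain ⟨a, ha, b, hb, hab⟩ := hI'.exists_lt
    refine uniqueDiffOn_convex hI.convex ⟨(a + b) / 2, ?_⟩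
    exact interior_mono (hI.out ha hb) (by
      rw [interior_Icc]
      constructor <;> linarith)
  refine ⟨ShapeSpace.horizontalReparam hI hIu h0 hA n, fun m c hc => ?_, fun c =>
    ⟨fun z => ?_, ShapeSpace.isHorizontal_horizontalReparam hI hIu h0 hA n c⟩⟩
  · exact ShapeSpace.smoothInParam_of_flow hI hIu
      ((ShapeSpace.isSmoothLiftFamily_of_smoothInParam hc).contDiffOn_field hI hIu hA n).1
      (fun p => (c p).isPeriodicField hI hIu hA n) h0
      fun p t x => ShapeSpace.horizontalReparam_circleExp hI hIu h0 hA n (c p) t x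
  · obtain ⟨x, rfl⟩ := Circle.exp_surjective z
    rw [ShapeSpace.horizontalReparam_circleExp]
    exact congrArg _ ((c.isPeriodicField hI hIu hA n).flow_spec hI hIu Real.two_pi_pos h0 x).1
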